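/- **Model.** A dynamic graph consists of a finite simple graph $G=(V,E)$ (the underlying graph) and edge sets $\mathcal{E}(t)\subseteq E$, $t\in\mathbb{N}=\{0,1,2,\dots\}$. The nodes carry distinct labels in $\mathbb{N}$, and the edges of $G$ at each node $v$ are numbered by distinct ports $1,\dots,\deg_G(v)$. For an integer $T\ge 1$ the dynamic graph is $T$-interval-connected if $\bigl(V,\bigcap_{i=t}^{t+T-1}\mathcal{E}(i)\bigr)$ is connected for every $t\in\mathbb{N}$. Its numbers of nodes and edges are $n=|V|$ and $m=|E|$. A single agent starts at an arbitrary node. At each time $t$, in the $KT_0$ model, it observes the label and the degree in $G$ of its current node, the set of ports there whose edges belong to $\mathcal{E}(t)$, and the port through which it arrived (none at time $0$); in the $KT_1$ model it also observes, for each neighbour of its current node in $(V,\mathcal{E}(t))$, the label of that neighbour and the port leading to it. It then either moves through an available port or terminates; a deterministic algorithm determines this choice from all observations made so far. An agent explores the dynamic graph if it visits all nodes and terminates. For $k\in\{0,1\}$, $n\ge 3$ and $n\le m\le\binom n2$, let $\psi_k(n,m)$ be the minimum integer $T\ge 1$ such that there is a deterministic algorithm with which a single agent explores, in the $KT_k$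 model and from every start node, every $T$-interval-connected dynamic graph with $n$ nodes and $m$ edges. Let $$\epsilon(n,m)=\frac{\ln n}{1+\ln m-\ln n}.$$ **Corollary.** For both $k\in\{0,1\}$, $\psi_k(n,m)=O\bigl(\epsilon(n,m)\cdot m+n\log^2 n\bigr)$, where $\log$ is the base-$2$ logarithm. That is, there is a constant $C>0$ such that for all $k\in\{0,1\}$, all $n\ge 3$ and all $m$ with $n\le m\le\binom n2$, the minimum $\psi_k(n,m)$ exists and $$\psi_k(n,m)\le C\bigl(\epsilon(n,m)\cdot m+n\log^2 n\bigr).$$ -/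

import Mathlib

namespace DynExplore

/-- A dynamic graph on the finite node set `V`: an underlying simple graph `G`, the snapshots
`snap t` (spanning subgraphs of `G`), distinct node labels `id`, and for every node `v` a
bijection `port v` from the neighbours of `v` in `G` onto `{1, …, deg v}`. An edge of `G` need not
ever appear. The values of `port v` outside the neighbourhood of `v` play no role. -/
structure DynGraph (V : Type) [Fintype V] where
  G : SimpleGraph V
  snap : ℕ → SimpleGraph V
  snap_le : ∀ t, snap t ≤ G
  id : V → ℕ
  id_injective : Function.Injective id
  port : V → V → ℕ
  port_bijOn : ∀ v, Set.BijOn (port v) (G.neighborSet v) (Set.Icc 1 (G.neighborSet v).ncard)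

/-- What the agent perceives in one time step: the label of its current node, the degree of that
node in the underlying graph, the set of ports available now, the incoming port (`none` at time
`0`), and the pairs (label, port) of the current neighbours (`none` where the model does not
reveal them). -/
@[ext] structure Obs where
  id : ℕ
  deg : ℕ
  ports : Finset ℕ
  pin : Option ℕ
  view : Option (Finset (ℕ × ℕ))

/-- A deterministic algorithm maps the list of all observations made so far (the last entry is the
current one) to a port, or to `none`, which means that the agent terminates. Nothing else is known
to the agent. -/
abbrev Algorithm : Type := List Obs → Option ℕ

namespace DynGraph

variable {V : Type} [Fintype V]

/-- `T`-interval connectivity (used for `T ≥ 1`): in every window `{t, …, t + T - 1}` the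
intersection of the snapshots is connected. -/
def IntervalConnected (D : DynGraph V) (T : ℕ) : Prop :=
  ∀ t : ℕ, (⨅ i ∈ Set.Ico t (t + T), D.snap i).Connected

open Classical in
/-- The neighbours of `v` in the snapshot at time `t`. -/
noncomputable def nbrs (D : DynGraph V) (v : V) (t : ℕ) : Finset V :=
  {u | (D.snap t).Adj v u}

/-- The incoming port at time `t` of an agent with trajectory `ν`. -/
def pin (D : DynGraph V) (ν : ℕ → V) : ℕ → Option ℕ
  | 0 => none
  | t + 1 => some (D.port (ν (t + 1)) (ν t))

/-- The observation at time `t` of an agent with trajectory `ν`, in the model `KT_k`. -/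
noncomputable def obs (D : DynGraph V) (k : Fin 2) (ν : ℕ → V) (t : ℕ) : Obs where
  id := D.id (ν t)
  deg := (D.G.neighborSet (ν t)).ncard
  ports := (D.nbrs (ν t) t).image (D.port (ν t))
  pin := D.pin ν t
  view := if k = 1 then some ((D.nbrs (ν t) t).image fun u => (D.id u, D.port (ν t) u)) else none

/-- The list of the observations at the times `0, …, t`. -/
noncomputable def history (D : DynGraph V) (k : Fin 2) (ν : ℕ → V) (t : ℕ) : List Obs :=
  (List.range (t + 1)).map (D.obs k ν)

/-- `ν 0, …, ν L` is the complete execution of `A` in the model `KT_k` from the start node `s`: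
at each time `t < L` the agent leaves `ν t` through the port selected by `A`, along an edge that
is present at time `t`, and at time `L` it terminates. (The values of `ν` after `L` play no
role.) -/
def IsExecution (D : DynGraph V) (k : Fin 2) (A : Algorithm) (s : V) (ν : ℕ → V) (L : ℕ) : Prop :=
  ν 0 = s ∧
  (∀ t < L, (D.snap t).Adj (ν t) (ν (t + 1)) ∧
    A (D.history k ν t) = some (D.port (ν t) (ν (t + 1)))) ∧
  A (D.history k ν L) = none

/-- An agent that runs `A` from `s` explores `D`: it visits all nodes and then terminates. -/
def ExploredBy (D : DynGraph V) (k : Fin 2) (A : Algorithm) (s : V) : Prop :=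
  ∃ (ν : ℕ → V) (L : ℕ), D.IsExecution k A s ν L ∧ ∀ v : V, ∃ t ≤ L, ν t = v

end DynGraph

/-- The window sizes `T ≥ 1` for which some deterministic algorithm explores, in the model `KT_k`
and from every start node, every `T`-interval-connected dynamic graph with `n` nodes and `m`
edges. -/
def windowSizes (k : Fin 2) (n m : ℕ) : Set ℕ :=
  {T | 1 ≤ T ∧ ∃ A : Algorithm, ∀ (V : Type) [Fintype V] (D : DynGraph V),
    Fintype.card V = n → D.G.edgeSet.ncard = m → D.IntervalConnected T →
      ∀ s : V, D.ExploredBy k A s}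

/-- `ψ_k(n,m)`: the minimum of the sufficient window sizes. -/
noncomputable def psi (k : Fin 2) (n m : ℕ) : ℕ := sInf (windowSizes k n m)

/-- `ε(n,m) = ln n / (1 + ln m - ln n)`. -/
noncomputable def eps (n m : ℕ) : ℝ := Real.log n / (1 + Real.log m - Real.log n)

end DynExplore

/-!
The agent works in phases. It remembers the graph of all edges it has traversed, and for the current
phase the graph `H` of those known edges that it has not yet seen to be absent. Whenever an unknown
port is available it leaves through it; then a new edge becomes known and a new phase starts, which
happens at most `m` times. Otherwise it follows a shortest walk in `H` that covers all reachable nodes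
not yet visited in this phase, recomputed at each step. During a window of `T` steps a connected
spanning subgraph is permanently present. While some node has never been visited, an edge of it leads
out of every component of its known part, so it offers an unknown port at some node of the
component (`Phase.exists_reachable`). It remains to bound the duration of a phase.

The potential is the length of the shortest covering walk plus twice the total excess of `H`. A move
decreases it. When an edge at the current node is deleted, the covering walk does not get longer if
the edge is a bridge; if it has a detour of length `d`, the walk grows by at most `2 * d`, since a
shortest covering walk uses no edge twice in the same direction (`exists_walk_darts_nodup`). The total
excess pays for this: it is the sum over `l ≤ n` of the largest cyclomatic number of a subgraph of `H`
in which all detours of edges have length at least `l`, and each of the summands for `l ≤ d` drops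
(`Covers.delete_incident`).

A graph in which all detours have length at least `l` consists of a forest and at most
`n * (n ^ (1 / (l / 2)) - 1)` further edges: balls of radius less than `l / 2` are trees, and one can
cut out balls whose boundary is small compared with their size (`excess_le_mul_card`). Together with
the trivial bound `m` this sums up to `O(ε * m + n * log² n)` (`totalExcess_le`). The label and port
information of the model `KT_0` suffices throughout.
-/

namespace DynExplore

open SimpleGraph

/-! ### Covering walks -/

section CoveringWalks

variable {V : Type*}

/-- `Covers H U x k`: some walk of length `k` in `H` starts at `x` and visits every vertex of `U`
that is reachable from `x`. -/
def Covers (H : SimpleGraph V) (U : Set V) (x : V) (k : ℕ) : Prop :=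
  ∃ (y : V) (p : H.Walk x y), p.length = k ∧ ∀ z ∈ U, H.Reachable x z → z ∈ p.support

theorem exists_walk_of_map_adj_or_eq {H H' : SimpleGraph V} (r : V → V)
    (hr : ∀ a b, H.Adj a b → r a = r b ∨ H'.Adj (r a) (r b)) {x y : V} (p : H.Walk x y) :
    ∃ q : H'.Walk (r x) (r y), q.length ≤ p.length ∧ ∀ z ∈ p.support, r z ∈ q.support := by
  induction p with
  | nil => exact ⟨.nil, by simp, by simp⟩
  | @cons a b c h p ih =>
    obtain ⟨q, hq, hs⟩ := ih
    rcases hr a b h with e | e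
    · refine ⟨q.copy e.symm rfl, by simp; omega, ?_⟩
      intro z hz
      rw [Walk.support_cons, List.mem_cons] at hz
      rcases hz with rfl | hz
      · simp [e]
      · simpa using hs z hz
    · refine ⟨.cons e q, by simp; omega, ?_⟩
      intro z hz
      rw [Walk.support_cons, List.mem_cons] at hz
      rcases hz with rfl | hz
      · simp
      · simp [hs z hz]

/-- Replace every use of the edge `uw` in a walk by the detour `q`. -/
theorem exists_walk_of_detour [DecidableEq V] {H H' : SimpleGraph V} {u w : V}
    (hle : ∀ a b, H.Adj a b → s(a, b) ≠ s(u, w) → H'.Adj a b) (q : H'.Walk u w) {x y : V}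
    (p : H.Walk x y) (n : ℕ) (hn : p.darts.countP (fun d => d.toProd = (u, w)) +
      p.darts.countP (fun d => d.toProd = (w, u)) ≤ n) :
    ∃ p' : H'.Walk x y, p'.length ≤ p.length + n * q.length ∧
      ∀ z ∈ p.support, z ∈ p'.support := by
  induction p generalizing n with
  | nil => exact ⟨.nil, by simp, by simp⟩
  | @cons a b c h p ih =>
    rw [Walk.darts_cons, List.countP_cons, List.countP_cons] at hn
    by_cases e : s(a, b) = s(u, w)
    · have : ∃ d : H'.Walk a b, d.length = q.length := by
        rcases Sym2.eq_iff.1 e with ⟨rfl, rfl⟩ | ⟨rfl, rfl⟩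
        · exact ⟨q, rfl⟩
        · exact ⟨q.reverse, by simp⟩
      obtain ⟨d, hd⟩ := this
      have : 1 ≤ n ∧ p.darts.countP (fun d => d.toProd = (u, w)) +
          p.darts.countP (fun d => d.toProd = (w, u)) ≤ n - 1 := by
        rcases Sym2.eq_iff.1 e with ⟨rfl, rfl⟩ | ⟨rfl, rfl⟩
        · simp only [decide_true, if_true] at hn
          omega
        · simp only [decide_true, if_true] at hn
          omega
      obtain ⟨p', h1, h2⟩ := ih (n - 1) this.2
      refine ⟨d.append p', ?_, ?_⟩
      · rw [Walk.length_append, Walk.length_cons, hd]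
        obtain ⟨n, rfl⟩ : ∃ n', n = n' + 1 := ⟨n - 1, by omega⟩
        simp only [Nat.add_sub_cancel] at h1
        nlinarith
      · intro z hz
        rw [Walk.support_cons, List.mem_cons] at hz
        rw [Walk.mem_support_append_iff]
        rcases hz with rfl | hz
        · simp
        · exact .inr (h2 z hz)
    · obtain ⟨p', h1, h2⟩ := ih n (by omega)
      refine ⟨.cons (hle a b h e) p', by simp; omega, ?_⟩
      intro z hz
      rw [Walk.support_cons, List.mem_cons] at hz
      rcases hz with rfl | hz
      · simp
      · simp [h2 z hz]

theorem exists_append_cons_of_mem_darts {H : SimpleGraph V} {x y : V} (p : H.Walk x y)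
    (d : H.Dart) (hd : d ∈ p.darts) :
    ∃ (A : H.Walk x d.fst) (B : H.Walk d.snd y), p = A.append (.cons d.adj B) := by
  induction p with
  | nil => simp at hd
  | @cons a b c h p ih =>
    rw [Walk.darts_cons, List.mem_cons] at hd
    rcases hd with rfl | hd
    · exact ⟨.nil, p, rfl⟩
    · obtain ⟨A, B, e⟩ := ih hd
      exact ⟨.cons h A, B, by rw [e]; rfl⟩

/-- A walk `x → v A x → v B` that uses a dart twice can be replaced by `A.reverse B`, which visits
the same vertices. Hence a shortest walk visiting given vertices uses no dart twice. -/
theorem exists_walk_darts_nodup {H : SimpleGraph V} {x y : V} (p : H.Walk x y) :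
    ∃ p' : H.Walk x y, p'.length ≤ p.length ∧ (∀ z ∈ p.support, z ∈ p'.support) ∧
      p'.darts.Nodup := by
  obtain ⟨n, hn⟩ : ∃ n, p.length ≤ n := ⟨_, le_rfl⟩
  induction n generalizing x p with
  | zero =>
    cases p with
    | nil => exact ⟨.nil, by simp⟩
    | cons h p => simp at hn
  | succ n ih =>
    cases p with
    | nil => exact ⟨.nil, by simp⟩
    | @cons _ v _ h p =>
      rw [Walk.length_cons] at hn
      obtain ⟨q, h1, h2, h3⟩ := ih p (by omega)
      by_cases hd : (⟨(x, v), h⟩ : H.Dart) ∈ q.darts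
      · obtain ⟨A, B, e⟩ := exists_append_cons_of_mem_darts q _ hd
        have hl : q.length = A.length + (B.length + 1) := by rw [e]; simp
        obtain ⟨r, g1, g2, g3⟩ := ih (A.reverse.append B) (by
          rw [Walk.length_append, Walk.length_reverse]; omega)
        rw [Walk.length_append, Walk.length_reverse] at g1
        refine ⟨r, by rw [Walk.length_cons]; omega, ?_, g3⟩
        intro z hz
        apply g2
        rw [Walk.support_cons, List.mem_cons] at hz
        rw [Walk.mem_support_append_iff, Walk.support_reverse, List.mem_reverse]
        rcases hz with rfl | hz
        · left; simp
        · have := h2 z hz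
          rw [e, Walk.mem_support_append_iff, Walk.support_cons, List.mem_cons] at this
          rcases this with hz | hz | hz
          · exact .inl hz
          · left; rw [hz]; simp
          · exact .inr hz
      · refine ⟨.cons h q, by simp; omega, ?_, ?_⟩
        · intro z hz
          rw [Walk.support_cons, List.mem_cons] at hz
          rcases hz with rfl | hz
          · simp
          · simp [h2 z hz]
        · rw [Walk.darts_cons, List.nodup_cons]
          exact ⟨hd, h3⟩

theorem countP_darts_le_one {H : SimpleGraph V} [DecidableEq V] {l : List H.Dart} (h : l.Nodup)
    (a : V × V) : l.countP (fun d => d.toProd = a) ≤ 1 := by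
  classical
  by_cases ha : H.Adj a.1 a.2
  · have : l.countP (fun d => d.toProd = a) = l.count ⟨a, ha⟩ := by
      rw [List.count]
      apply List.countP_congr
      intro d _
      simp [Dart.ext_iff]
    rw [this]
    exact List.nodup_iff_count_le_one.1 h _
  · rw [List.countP_eq_zero.2]
    · simp
    · intro d _ hd
      simp only [decide_eq_true_eq] at hd
      exact ha (hd ▸ d.adj)

theorem Covers.mono {H : SimpleGraph V} {U U' : Set V} {x : V} {k : ℕ} (h : Covers H U x k)
    (hU : U' ⊆ U) : Covers H U' x k := by
  obtain ⟨y, p, hp, hs⟩ := h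
  exact ⟨y, p, hp, fun z hz => hs z (hU hz)⟩

/-- Deleting a bridge at the current vertex `x` cuts off a part of the graph, and a covering walk of
the rest is obtained by leaving out the excursions to it. -/
theorem Covers.delete_bridge {H H' : SimpleGraph V} {x w : V}
    (hle : ∀ a b, H.Adj a b → s(a, b) ≠ s(x, w) → H'.Adj a b) (hle' : H' ≤ H)
    (hbr : ¬ H'.Reachable x w) {U : Set V} {k : ℕ} (h : Covers H U x k) :
    ∃ k' ≤ k, Covers H' U x k' := by
  classical
  obtain ⟨y, p, hp, hs⟩ := h
  -- Collapse everything outside the component of `x` to `x`.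
  let r : V → V := fun z => if H'.Reachable x z then z else x
  have hrx : r x = x := by simp [r]
  have hr : ∀ a b, H.Adj a b → r a = r b ∨ H'.Adj (r a) (r b) := by
    intro a b hab
    by_cases e : s(a, b) = s(x, w)
    · left
      rcases Sym2.eq_iff.1 e with ⟨rfl, rfl⟩ | ⟨rfl, rfl⟩ <;> simp [r, hbr]
    · have hab' := hle a b hab e
      by_cases ha : H'.Reachable x a
      · right
        have hb : H'.Reachable x b := ha.trans hab'.reachable
        simpa [r, ha, hb] using hab'
      · left
        have hb : ¬ H'.Reachable x b := fun hb => ha (hb.trans hab'.symm.reachable)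
        simp [r, ha, hb]
  obtain ⟨q, h1, h2⟩ := exists_walk_of_map_adj_or_eq r hr p
  refine ⟨q.length, by omega, r y, q.copy hrx rfl, by simp, ?_⟩
  intro z hz hxz
  have := h2 z (hs z hz (hxz.mono hle'))
  simpa [r, hxz] using this

/-- Deleting an edge with a detour `q` lengthens a shortest covering walk by at most `2 * q.length`,
because it uses the edge at most once in each direction. -/
theorem Covers.delete_detour {H H' : SimpleGraph V} {x w : V}
    (hle : ∀ a b, H.Adj a b → s(a, b) ≠ s(x, w) → H'.Adj a b) (hle' : H' ≤ H)
    (q : H'.Walk x w) {U : Set V} {k : ℕ} (h : Covers H U x k) :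
    ∃ k' ≤ k + 2 * q.length, Covers H' U x k' := by
  classical
  obtain ⟨y, p, hp, hs⟩ := h
  obtain ⟨p', h1, h2, h3⟩ := exists_walk_darts_nodup p
  obtain ⟨p'', g1, g2⟩ := exists_walk_of_detour hle q p' 2
    (add_le_add (countP_darts_le_one h3 _) (countP_darts_le_one h3 _))
  exact ⟨_, by omega, y, p'', rfl, fun z hz hxz => g2 z (h2 z (hs z hz (hxz.mono hle')))⟩

theorem exists_covers_le [Finite V] (H : SimpleGraph V) (U : Set V) (x : V) :
    ∃ k ≤ 2 * H.edgeSet.ncard, Covers H U x k := by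
  classical
  have := Fintype.ofFinite V
  have key : ∀ s : Finset V, ∃ (y : V) (p : H.Walk x y),
      ∀ z ∈ s, H.Reachable x z → z ∈ p.support := by
    intro s
    induction s using Finset.induction_on with
    | empty => exact ⟨x, .nil, by simp⟩
    | insert a s _ ih =>
      obtain ⟨y, p, hp⟩ := ih
      by_cases ha : H.Reachable x a
      · obtain ⟨q⟩ := p.reachable.symm.trans ha
        refine ⟨a, p.append q, ?_⟩
        intro z hz hxz
        rw [Walk.mem_support_append_iff]
        rcases Finset.mem_insert.1 hz with rfl | hz
        · right; simp
        · exact .inl (hp z hz hxz)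
      · refine ⟨y, p, ?_⟩
        intro z hz hxz
        rcases Finset.mem_insert.1 hz with rfl | hz
        · exact absurd hxz ha
        · exact hp z hz hxz
  obtain ⟨y, p, hp⟩ := key Finset.univ
  obtain ⟨p', _, h2, h3⟩ := exists_walk_darts_nodup p
  refine ⟨p'.length, ?_, y, p', rfl, fun z _ hxz => h2 z (hp z (by simp) hxz)⟩
  have e : H.edgeSet.ncard = H.edgeFinset.card := by
    rw [← coe_edgeFinset, Set.ncard_coe_finset]
  rw [e, ← dart_card_eq_twice_card_edges, ← Walk.length_darts]
  exact h3.length_le_card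

/-- As long as a reachable vertex of `U` is left, the next vertex of a shortest covering walk is
strictly closer to completing the tour. -/
theorem exists_adj_covers {H : SimpleGraph V} {U : Set V} {x : V} (hx : x ∉ U) {z : V}
    (hz : z ∈ U) (hxz : H.Reachable x z) (hk : ∃ k, Covers H U x k) :
    ∃ w k, H.Adj x w ∧ Covers H U w k ∧ ∀ j, Covers H U x j → k < j := by
  classical
  obtain ⟨y, p, hp, hs⟩ := Nat.find_spec hk
  have hmin : ∀ j, Covers H U x j → Nat.find hk ≤ j := fun j hj => Nat.find_min' hk hj
  cases p with
  | nil =>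
    have := hs z hz hxz
    simp only [Walk.support_nil, List.mem_singleton] at this
    exact absurd (this ▸ hz) hx
  | @cons _ w _ h p =>
    refine ⟨w, p.length, h, ⟨y, p, rfl, ?_⟩, ?_⟩
    · intro z' hz' hr
      have := hs z' hz' (h.reachable.trans hr)
      rw [Walk.support_cons, List.mem_cons] at this
      rcases this with rfl | h'
      · exact absurd hz' hx
      · exact h'
    · intro j hj
      have := hmin j hj
      rw [Walk.length_cons] at hp
      omega

theorem exists_map_walk {W : Type*} (f : V ↪ W) {H : SimpleGraph V} {x y : V} (p : H.Walk x y) :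
    ∃ q : (H.map f).Walk (f x) (f y), q.length = p.length ∧ q.support = p.support.map f :=
  ⟨p.map (Embedding.map f H).toHom, Walk.length_map _ _, Walk.support_map _ _⟩

theorem exists_walk_of_walk_map {W : Type*} (f : V ↪ W) {H : SimpleGraph V} {a b : W}
    (p : (H.map f).Walk a b) (x : V) (hx : f x = a) :
    ∃ (y : V) (q : H.Walk x y), f y = b ∧ q.length = p.length ∧ p.support = q.support.map f := by
  induction p generalizing x with
  | nil => exact ⟨x, .nil, hx, by simp, by simp [hx]⟩
  | @cons a b c h p ih =>
    obtain ⟨u, v, huv, hu, hv⟩ := (SimpleGraph.map_adj f H a b).1 h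
    have : u = x := f.injective (hu.trans hx.symm)
    subst this
    obtain ⟨y, q, h1, h2, h3⟩ := ih v hv
    exact ⟨y, .cons huv q, h1, by simp [h2], by simp [h3, hx]⟩

/-- Covering walks only depend on the graph up to an injective relabelling of its vertices. -/
theorem covers_map_iff {W : Type*} (f : V ↪ W) {H : SimpleGraph V} {U : Set W} {x : V} {k : ℕ} :
    Covers (H.map f) U (f x) k ↔ Covers H (f ⁻¹' U) x k := by
  constructor
  · rintro ⟨b, p, hp, hs⟩
    obtain ⟨y, q, h1, h2, h3⟩ := exists_walk_of_walk_map f p x rfl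
    refine ⟨y, q, by omega, ?_⟩
    rintro z hz ⟨r⟩
    obtain ⟨r', -, -⟩ := exists_map_walk f r
    have := hs (f z) hz ⟨r'⟩
    rw [h3, List.mem_map] at this
    obtain ⟨z', h, e⟩ := this
    exact f.injective e ▸ h
  · rintro ⟨y, p, hp, hs⟩
    obtain ⟨p', e1, e2⟩ := exists_map_walk f p
    refine ⟨f y, p', by omega, ?_⟩
    rintro z hz ⟨r⟩
    obtain ⟨z, q, rfl, -, -⟩ := exists_walk_of_walk_map f r x rfl
    have := hs z hz ⟨q⟩
    rw [e2, List.mem_map]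
    exact ⟨z, this, rfl⟩

end CoveringWalks

/-! ### The excess of a graph and edge deletions -/

section Excess

variable {V : Type*}

/-- Every detour around an edge of `F`, that is, every walk between the endpoints which avoids the
edge, has length at least `l`. In other words, the girth of `F` is greater than `l`. -/
def LongDetours (F : SimpleGraph V) (l : ℕ) : Prop :=
  ∀ u w, F.Adj u w → ∀ p : F.Walk u w, s(u, w) ∉ p.edges → l ≤ p.length

/-- The largest number of edges of a subgraph of `H` all of whose detours have length at least
`l`. -/
noncomputable def maxSparse (l : ℕ) (H : SimpleGraph V) : ℕ :=
  sSup {k | ∃ F ≤ H, LongDetours F l ∧ F.edgeSet.ncard = k}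

/-- The largest cyclomatic number that subgraphs of `H` with detours of length at least `l` can
have, where components are counted in `H`: edges minus vertices plus components. The subtraction
never truncates, see `card_le_maxSparse_add`. -/
noncomputable def excess (l : ℕ) (H : SimpleGraph V) : ℕ :=
  maxSparse l H + Nat.card H.ConnectedComponent - Nat.card V

/-- The total excess over all detour lengths. A deletion with a detour of length `d` decreases it by
at least `d`. -/
noncomputable def totalExcess (H : SimpleGraph V) : ℕ :=
  ∑ l ∈ Finset.Icc 1 (Nat.card V), excess l H

theorem longDetours_bot (l : ℕ) : LongDetours (⊥ : SimpleGraph V) l :=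
  fun _ _ h => absurd h (by simp)

/-- Adding back an edge all of whose detours are long cannot create a short detour of another edge:
the two would lie on a common short cycle. -/
theorem LongDetours.sup_edge {l : ℕ} {F H : SimpleGraph V} {x w : V} (hF : F ≤ H)
    (hl : LongDetours F l) (hd : ∀ p : H.Walk x w, l ≤ p.length) :
    LongDetours (F ⊔ edge x w) l := by
  classical
  have hadj : ∀ {a b}, (F ⊔ edge x w).Adj a b → s(a, b) ≠ s(x, w) → F.Adj a b := by
    intro a b h ne
    rcases h with h | h
    · exact h
    · rw [edge_adj] at h
      exact absurd (Sym2.eq_iff.2 h.1) ne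
  have hsym : ∀ {a b}, s(a, b) = s(x, w) → ∀ p : H.Walk a b, l ≤ p.length := by
    intro a b e p
    rcases Sym2.eq_iff.1 e with ⟨rfl, rfl⟩ | ⟨rfl, rfl⟩
    · exact hd p
    · simpa using hd p.reverse
  have htr : ∀ {a b} (p : (F ⊔ edge x w).Walk a b), s(x, w) ∉ p.edges →
      ∀ e ∈ p.edges, e ∈ F.edgeSet := by
    intro a b p hp e he
    have h1 := p.edges_subset_edgeSet he
    induction e with
    | _ c d => exact hadj h1 (fun h => hp (h ▸ he))
  intro a b hab p hp
  suffices ∀ p : (F ⊔ edge x w).Walk a b, s(a, b) ∉ p.edges → p.IsPath → l ≤ p.length by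
    exact (this p.bypass (fun h => hp (p.edges_bypass_subset_edges h)) p.bypass_isPath).trans
      p.length_bypass_le_length
  clear hp p
  intro p hp hpath
  by_cases e : s(a, b) = s(x, w)
  · simpa using hsym e ((p.transfer F (htr p (e ▸ hp))).mapLe hF)
  have hab' := hadj hab e
  by_cases hmem : s(x, w) ∈ p.edges
  · obtain ⟨d, hdp, hde⟩ := List.mem_map.1 hmem
    obtain ⟨A, B, rfl⟩ := exists_append_cons_of_mem_darts p d hdp
    have hnd := hpath.isTrail.edges_nodup
    rw [Walk.edges_append, Walk.edges_cons] at hnd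
    have hde' : s(d.fst, d.snd) = s(x, w) := by rw [← hde]; rfl
    rw [hde'] at hnd
    have hA : s(x, w) ∉ A.edges := fun h => by
      have := List.disjoint_of_nodup_append hnd h
      simp at this
    have hB : s(x, w) ∉ B.edges := by
      have := (List.nodup_append.1 hnd).2.1
      exact (List.nodup_cons.1 this).1
    have := hsym hde' (((A.transfer F (htr A hA)).reverse.append
      (.cons hab' (B.transfer F (htr B hB)).reverse)).mapLe hF)
    simp only [Walk.length_map, Walk.length_append, Walk.length_reverse, Walk.length_cons,
      Walk.length_transfer] at this ⊢
    omega
  · have := hl a b hab' (p.transfer F (htr p hmem)) (by simpa using hp)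
    simpa using this

/-- Two vertices that get separated by the deletion of `xw` are cut off on different sides of it. -/
theorem reachable_deleteEdges {H : SimpleGraph V} {x w a b : V} (p : H.Walk a b) :
    (H.deleteEdges {s(x, w)}).Reachable a b ∨
      ((H.deleteEdges {s(x, w)}).Reachable a x ∧ (H.deleteEdges {s(x, w)}).Reachable w b) ∨
      ((H.deleteEdges {s(x, w)}).Reachable a w ∧ (H.deleteEdges {s(x, w)}).Reachable x b) := by
  induction p with
  | nil => exact .inl .rfl
  | @cons a c b h p ih =>
    by_cases e : s(a, c) = s(x, w)
    · rcases Sym2.eq_iff.1 e with ⟨rfl, rfl⟩ | ⟨rfl, rfl⟩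
      · rcases ih with ih | ih | ih
        · exact .inr (.inl ⟨.rfl, ih⟩)
        · exact .inr (.inl ⟨.rfl, ih.2⟩)
        · exact .inl ih.2
      · rcases ih with ih | ih | ih
        · exact .inr (.inr ⟨.rfl, ih⟩)
        · exact .inl ih.2
        · exact .inr (.inr ⟨.rfl, ih.2⟩)
    · have h' : (H.deleteEdges {s(x, w)}).Reachable a c :=
        Adj.reachable (by rw [deleteEdges_adj]; exact ⟨h, e⟩)
      rcases ih with ih | ih | ih
      · exact .inl (h'.trans ih)
      · exact .inr (.inl ⟨h'.trans ih.1, ih.2⟩)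
      · exact .inr (.inr ⟨h'.trans ih.1, ih.2⟩)

variable [Finite V]

theorem bddAbove_sparse (l : ℕ) (H : SimpleGraph V) :
    BddAbove {k | ∃ F ≤ H, LongDetours F l ∧ F.edgeSet.ncard = k} := by
  refine ⟨H.edgeSet.ncard, ?_⟩
  rintro _ ⟨F, hF, -, rfl⟩
  exact Set.ncard_le_ncard (edgeSet_subset_edgeSet.2 hF) (Set.toFinite _)

theorem ncard_le_maxSparse {l : ℕ} {F H : SimpleGraph V} (hF : F ≤ H) (h : LongDetours F l) :
    F.edgeSet.ncard ≤ maxSparse l H :=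
  le_csSup (bddAbove_sparse l H) ⟨F, hF, h, rfl⟩

theorem exists_ncard_eq_maxSparse (l : ℕ) (H : SimpleGraph V) :
    ∃ F ≤ H, LongDetours F l ∧ F.edgeSet.ncard = maxSparse l H :=
  Nat.sSup_mem (s := {k | ∃ F ≤ H, LongDetours F l ∧ F.edgeSet.ncard = k})
    ⟨_, ⊥, bot_le, longDetours_bot l, rfl⟩ (bddAbove_sparse l H)

theorem maxSparse_mono {l : ℕ} {H H' : SimpleGraph V} (h : H' ≤ H) :
    maxSparse l H' ≤ maxSparse l H := by
  obtain ⟨F, hF, hl, e⟩ := exists_ncard_eq_maxSparse l H'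
  exact e ▸ ncard_le_maxSparse (hF.trans h) hl

theorem maxSparse_deleteEdges_lt {l : ℕ} {H : SimpleGraph V} {x w : V} (h : H.Adj x w)
    (hd : ∀ p : (H.deleteEdges {s(x, w)}).Walk x w, l ≤ p.length) :
    maxSparse l (H.deleteEdges {s(x, w)}) < maxSparse l H := by
  obtain ⟨F, hF, hl, e⟩ := exists_ncard_eq_maxSparse l (H.deleteEdges {s(x, w)})
  have hle : F ⊔ edge x w ≤ H :=
    sup_le (hF.trans (deleteEdges_le _)) (by rw [edge_le_iff]; exact .inr h)
  refine lt_of_lt_of_le ?_ (ncard_le_maxSparse hle (hl.sup_edge hF hd))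
  rw [← e]
  refine Set.ncard_lt_ncard ⟨edgeSet_subset_edgeSet.2 le_sup_left, fun hs => ?_⟩ (Set.toFinite _)
  have h1 : (F ⊔ edge x w).Adj x w := .inr (by rw [edge_adj]; exact ⟨.inl ⟨rfl, rfl⟩, h.ne⟩)
  have h2 : F.Adj x w := hs ((mem_edgeSet _).2 h1)
  have := hF h2
  simp at this

theorem card_component_deleteEdges_le_succ (H : SimpleGraph V) (x w : V) :
    Nat.card (H.deleteEdges {s(x, w)}).ConnectedComponent ≤ Nat.card H.ConnectedComponent + 1 := by
  classical
  set H' := H.deleteEdges {s(x, w)} with hH'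
  have hle : H' ≤ H := deleteEdges_le _
  let f : H'.ConnectedComponent → Option H.ConnectedComponent := fun C =>
    if C = H'.connectedComponentMk w then none else some (C.map (Hom.ofLE hle))
  have hf : Function.Injective f := by
    intro C D h
    induction C using ConnectedComponent.ind with | _ a
    induction D using ConnectedComponent.ind with | _ b
    simp only [f] at h
    split_ifs at h with h1 h2 h2
    · exact h1.trans h2.symm
    · simp only [ConnectedComponent.map_mk, Option.some.injEq, ConnectedComponent.eq] at h h1 h2 ⊢
      obtain ⟨p⟩ := h
      rcases reachable_deleteEdges (x := x) (w := w) p with h | h | h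
      · exact h
      · exact absurd h.2.symm h2
      · exact absurd h.1 h1
  have := Nat.card_le_card_of_injective f hf
  rwa [Finite.card_option] at this

theorem card_component_deleteEdges_le {H : SimpleGraph V} {x w : V}
    (h : (H.deleteEdges {s(x, w)}).Reachable x w) :
    Nat.card (H.deleteEdges {s(x, w)}).ConnectedComponent ≤ Nat.card H.ConnectedComponent := by
  have hle : H.deleteEdges {s(x, w)} ≤ H := deleteEdges_le _
  refine Nat.card_le_card_of_injective
    (fun C : (H.deleteEdges {s(x, w)}).ConnectedComponent => C.map (Hom.ofLE hle)) ?_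
  intro C D hCD
  induction C using ConnectedComponent.ind with | _ a
  induction D using ConnectedComponent.ind with | _ b
  simp only [ConnectedComponent.map_mk, ConnectedComponent.eq] at hCD ⊢
  obtain ⟨p⟩ := hCD
  rcases reachable_deleteEdges (x := x) (w := w) p with h' | h' | h'
  · exact h'
  · exact h'.1.trans (h.trans h'.2)
  · exact h'.1.trans (h.symm.trans h'.2)

theorem maxSparse_add_card_component_deleteEdges_le {l : ℕ} {H : SimpleGraph V} {x w : V}
    (h : H.Adj x w) :
    maxSparse l (H.deleteEdges {s(x, w)}) +
      Nat.card (H.deleteEdges {s(x, w)}).ConnectedComponent ≤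
        maxSparse l H + Nat.card H.ConnectedComponent := by
  by_cases hr : (H.deleteEdges {s(x, w)}).Reachable x w
  · exact add_le_add (maxSparse_mono (deleteEdges_le _)) (card_component_deleteEdges_le hr)
  · have h1 := card_component_deleteEdges_le_succ H x w
    have h2 := maxSparse_deleteEdges_lt (l := l) h (fun p => absurd p.reachable hr)
    omega

theorem ncard_edgeSet_deleteEdges_lt {H : SimpleGraph V} {x w : V} (h : H.Adj x w) :
    (H.deleteEdges {s(x, w)}).edgeSet.ncard < H.edgeSet.ncard := by
  refine Set.ncard_lt_ncard ⟨edgeSet_subset_edgeSet.2 (deleteEdges_le _), fun hs => ?_⟩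
    (Set.toFinite _)
  have : (H.deleteEdges {s(x, w)}).Adj x w := hs ((mem_edgeSet _).2 h)
  simp at this

theorem card_le_maxSparse_add (l : ℕ) (H : SimpleGraph V) :
    Nat.card V ≤ maxSparse l H + Nat.card H.ConnectedComponent := by
  obtain ⟨n, hn⟩ : ∃ n, H.edgeSet.ncard = n := ⟨_, rfl⟩
  induction n using Nat.strong_induction_on generalizing H with
  | _ n ih =>
    by_cases hH : H = ⊥
    · subst hH
      refine le_add_left (Nat.card_le_card_of_injective
        (⊥ : SimpleGraph V).connectedComponentMk ?_)
      intro a b hab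
      rwa [ConnectedComponent.eq, reachable_bot] at hab
    · obtain ⟨x, w, h⟩ := ne_bot_iff_exists_adj.1 hH
      exact (ih _ (hn ▸ ncard_edgeSet_deleteEdges_lt h) _ rfl).trans
        (maxSparse_add_card_component_deleteEdges_le h)

theorem excess_deleteEdges_le {l : ℕ} {H : SimpleGraph V} {x w : V} (h : H.Adj x w) :
    excess l (H.deleteEdges {s(x, w)}) ≤ excess l H :=
  Nat.sub_le_sub_right (maxSparse_add_card_component_deleteEdges_le h) _

theorem totalExcess_deleteEdges_le {H : SimpleGraph V} {x w : V} (h : H.Adj x w) :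
    totalExcess (H.deleteEdges {s(x, w)}) ≤ totalExcess H :=
  Finset.sum_le_sum fun _ _ => excess_deleteEdges_le h

theorem excess_deleteEdges_lt {l : ℕ} {H : SimpleGraph V} {x w : V} (h : H.Adj x w)
    (hr : (H.deleteEdges {s(x, w)}).Reachable x w)
    (hd : ∀ p : (H.deleteEdges {s(x, w)}).Walk x w, l ≤ p.length) :
    excess l (H.deleteEdges {s(x, w)}) + 1 ≤ excess l H := by
  have h1 := card_component_deleteEdges_le hr
  have h2 := maxSparse_deleteEdges_lt h hd
  have h3 := card_le_maxSparse_add l (H.deleteEdges {s(x, w)})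
  unfold excess
  omega

/-- A shortest detour of length `d` decreases each of the first `d` summands of the total excess. -/
theorem exists_walk_add_totalExcess_le {H : SimpleGraph V} {x w : V} (h : H.Adj x w)
    (hr : (H.deleteEdges {s(x, w)}).Reachable x w) :
    ∃ q : (H.deleteEdges {s(x, w)}).Walk x w,
      totalExcess (H.deleteEdges {s(x, w)}) + q.length ≤ totalExcess H := by
  classical
  have := Fintype.ofFinite V
  obtain ⟨q, hq, hd⟩ := hr.exists_path_of_dist
  refine ⟨q, ?_⟩
  have hlt : q.length < Nat.card V := by
    rw [Nat.card_eq_fintype_card]; exact hq.length_lt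
  have hmin : ∀ p : (H.deleteEdges {s(x, w)}).Walk x w, q.length ≤ p.length :=
    fun p => hd ▸ dist_le p
  unfold totalExcess
  calc _ = ∑ l ∈ Finset.Icc 1 (Nat.card V),
        (excess l (H.deleteEdges {s(x, w)}) + if l ≤ q.length then 1 else 0) := by
        rw [Finset.sum_add_distrib, Finset.sum_boole]
        congr 1
        have : Finset.filter (fun l => l ≤ q.length) (Finset.Icc 1 (Nat.card V)) =
            Finset.Icc 1 q.length := by
          ext l
          simp only [Finset.mem_filter, Finset.mem_Icc]
          omega
        rw [this]
        simp
    _ ≤ _ := by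
        refine Finset.sum_le_sum fun l _ => ?_
        split_ifs with hl
        · exact excess_deleteEdges_lt h hr fun p => hl.trans (hmin p)
        · exact excess_deleteEdges_le h

/-- The potential argument: deleting edges at the current vertex `x` does not increase the length
of a covering walk plus twice the total excess. -/
theorem Covers.delete_incident {H H' : SimpleGraph V} {x : V} (hle : H' ≤ H)
    (hx : ∀ a b, H.Adj a b → ¬ H'.Adj a b → a = x ∨ b = x) {U : Set V} {k : ℕ}
    (h : Covers H U x k) :
    ∃ k', Covers H' U x k' ∧ k' + 2 * totalExcess H' ≤ k + 2 * totalExcess H := by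
  obtain ⟨n, hn⟩ : ∃ n, H.edgeSet.ncard = n := ⟨_, rfl⟩
  induction n using Nat.strong_induction_on generalizing H k with
  | _ n ih =>
    by_cases hH : ∃ w, H.Adj x w ∧ ¬ H'.Adj x w
    · obtain ⟨w, h1, h2⟩ := hH
      have hle1 : H' ≤ H.deleteEdges {s(x, w)} := by
        intro a b hab
        rw [deleteEdges_adj]
        refine ⟨hle hab, fun e => ?_⟩
        rcases Sym2.eq_iff.1 e with ⟨rfl, rfl⟩ | ⟨rfl, rfl⟩
        · exact h2 hab
        · exact h2 hab.symm
      have hdel : ∀ a b, H.Adj a b → s(a, b) ≠ s(x, w) → (H.deleteEdges {s(x, w)}).Adj a b := by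
        intro a b hab e
        rw [deleteEdges_adj]
        exact ⟨hab, e⟩
      obtain ⟨k1, hk1, hc⟩ : ∃ k1, k1 + 2 * totalExcess (H.deleteEdges {s(x, w)}) ≤
          k + 2 * totalExcess H ∧ Covers (H.deleteEdges {s(x, w)}) U x k1 := by
        by_cases hr : (H.deleteEdges {s(x, w)}).Reachable x w
        · obtain ⟨q, hq⟩ := exists_walk_add_totalExcess_le h1 hr
          obtain ⟨k1, hk1, hc⟩ := h.delete_detour hdel (deleteEdges_le _) q
          exact ⟨k1, by omega, hc⟩
        · obtain ⟨k1, hk1, hc⟩ := h.delete_bridge hdel (deleteEdges_le _) hr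
          have := totalExcess_deleteEdges_le h1
          exact ⟨k1, by omega, hc⟩
      obtain ⟨k', hc', hk'⟩ := ih _ (hn ▸ ncard_edgeSet_deleteEdges_lt h1) hle1
        (fun a b hab => hx a b (deleteEdges_le _ hab)) hc rfl
      exact ⟨k', hc', by omega⟩
    · have : H = H' := by
        refine le_antisymm (fun a b hab => ?_) hle
        by_contra hab'
        rcases hx a b hab hab' with rfl | rfl
        · exact hH ⟨b, hab, hab'⟩
        · exact hH ⟨a, hab.symm, fun h => hab' h.symm⟩
      subst this
      exact ⟨k, h, le_rfl⟩

end Excess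

/-! ### Bounding the excess by ball growing -/

section BallGrowing

variable {V : Type*}

/-- Adjacent vertices lie in different layers of `ρ`, and every vertex has at most one neighbour in
a lower layer. Such a graph is a forest. -/
structure IsLayered (A : SimpleGraph V) (ρ : V → ℕ) : Prop where
  ne : ∀ y x, A.Adj y x → ρ y ≠ ρ x
  parent_unique : ∀ y x x', A.Adj y x → A.Adj y x' → ρ x < ρ y → ρ x' < ρ y → x = x'

theorem IsLayered.ncard_add_card_component_le [Finite V] {A : SimpleGraph V} {ρ : V → ℕ}
    (h : IsLayered A ρ) :
    A.edgeSet.ncard + Nat.card A.ConnectedComponent ≤ Nat.card V := by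
  classical
  -- The vertices with a lower neighbour correspond to the edges; every component has one without.
  let S : Set V := {y | ∃ x, A.Adj y x ∧ ρ x < ρ y}
  have hE : A.edgeSet.ncard ≤ S.ncard := by
    choose! f hf using fun (y : V) (hy : y ∈ S) => hy
    have : A.edgeSet ⊆ (fun y => s(y, f y)) '' S := by
      intro e he
      induction e with | _ a b
      have hab : A.Adj a b := he
      rcases lt_or_gt_of_ne (h.ne a b hab) with hlt | hlt
      · have hb : b ∈ S := ⟨a, hab.symm, hlt⟩
        refine ⟨b, hb, ?_⟩
        simp only [h.parent_unique b (f b) a (hf b hb).1 hab.symm (hf b hb).2 hlt]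
        exact Sym2.eq_swap
      · have ha : a ∈ S := ⟨b, hab, hlt⟩
        refine ⟨a, ha, ?_⟩
        simp only [h.parent_unique a (f a) b (hf a ha).1 hab (hf a ha).2 hlt]
    exact (Set.ncard_le_ncard this (Set.toFinite _)).trans (Set.ncard_image_le (Set.toFinite _))
  have hC : Nat.card A.ConnectedComponent ≤ Sᶜ.ncard := by
    rw [← Nat.card_coe_set_eq]
    refine Nat.card_le_card_of_surjective
      (fun y : (Sᶜ : Set V) => A.connectedComponentMk y) ?_
    intro C
    obtain ⟨y, hy, hmin⟩ := Set.exists_min_image C.supp ρ (Set.toFinite _) C.nonempty_supp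
    refine ⟨⟨y, ?_⟩, hy⟩
    rintro ⟨x, hx, hlt⟩
    have : x ∈ C.supp := by
      rw [ConnectedComponent.mem_supp_iff] at hy ⊢
      rw [← hy]
      exact ConnectedComponent.eq.2 hx.symm.reachable
    exact absurd (hmin x this) (by omega)
  have := Set.ncard_add_ncard_compl S
  omega

/-- A shortest walk from `z` to `v` only visits vertices that are closer to `v` than `z`. -/
theorem exists_walk_dist_lt {F : SimpleGraph V} {v z : V} (h : F.Reachable v z) :
    ∃ p : F.Walk z v, p.length = F.dist v z ∧
      ∀ a ∈ p.support, a = z ∨ F.dist v a < F.dist v z := by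
  classical
  obtain ⟨p, hp⟩ := h.symm.exists_walk_length_eq_dist
  rw [dist_comm] at hp
  refine ⟨p, hp, fun a ha => ?_⟩
  have h1 : p.length = (p.takeUntil a ha).length + (p.dropUntil a ha).length := by
    rw [← Walk.length_append, Walk.take_spec]
  have h2 : F.dist v a ≤ (p.dropUntil a ha).length := by
    rw [dist_comm]; exact dist_le _
  rcases Nat.eq_zero_or_pos (p.takeUntil a ha).length with h0 | h0
  · exact .inl (Walk.eq_of_length_eq_zero h0).symm
  · right; omega

theorem LongDetours.dist_ne {F : SimpleGraph V} {l : ℕ} (hF : LongDetours F l) {v x y : V}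
    (hx : F.Reachable v x) (hxy : F.Adj x y) (hl : 2 * F.dist v x < l) :
    F.dist v x ≠ F.dist v y := by
  intro e
  obtain ⟨p, hp, hps⟩ := exists_walk_dist_lt hx
  obtain ⟨q, hq, hqs⟩ := exists_walk_dist_lt (hx.trans hxy.reachable)
  have := hF x y hxy (p.append q.reverse) (by
    rw [Walk.edges_append, List.mem_append, Walk.edges_reverse, List.mem_reverse]
    rintro (h | h)
    · rcases hps y (p.snd_mem_support_of_mem_edges h) with h | h
      · exact hxy.ne h.symm
      · omega
    · rcases hqs x (q.fst_mem_support_of_mem_edges h) with h | h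
      · exact hxy.ne h
      · omega)
  rw [Walk.length_append, Walk.length_reverse] at this
  omega

theorem LongDetours.eq_of_dist_lt {F : SimpleGraph V} {l : ℕ} (hF : LongDetours F l) {v x x' y : V}
    (hy : F.Reachable v y) (hyx : F.Adj y x) (hyx' : F.Adj y x') (hx : F.dist v x < F.dist v y)
    (hx' : F.dist v x' < F.dist v y) (hl : 2 * F.dist v y ≤ l) : x = x' := by
  by_contra ne
  obtain ⟨p, hp, hps⟩ := exists_walk_dist_lt (hy.trans hyx.reachable)
  obtain ⟨q, hq, hqs⟩ := exists_walk_dist_lt (hy.trans hyx'.reachable)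
  have := hF y x hyx (.cons hyx' (q.append p.reverse)) (by
    rw [Walk.edges_cons, List.mem_cons, Walk.edges_append, List.mem_append, Walk.edges_reverse,
      List.mem_reverse]
    rintro (h | h | h)
    · rcases Sym2.eq_iff.1 h with h | h
      · exact ne h.2
      · exact hyx'.ne h.1
    · rcases hqs y (q.fst_mem_support_of_mem_edges h) with h | h
      · exact hyx'.ne h
      · omega
    · rcases hps y (p.fst_mem_support_of_mem_edges h) with h | h
      · exact hyx.ne h
      · omega)
  rw [Walk.length_cons, Walk.length_append, Walk.length_reverse] at this
  omega

theorem LongDetours.mono {F F' : SimpleGraph V} {l : ℕ} (hF : LongDetours F l) (h : F' ≤ F) :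
    LongDetours F' l := by
  intro u w huw p hp
  have := hF u w (h huw) (p.mapLe h) (by simpa [Walk.mapLe] using hp)
  simpa using this

open Classical in
/-- Balls grow by a factor greater than `β` at most `k - 1` times before they exhaust the
graph. -/
theorem exists_ball_card_le [Fintype V] (F : SimpleGraph V) (v : V) {β : ℝ} (hβ : 1 ≤ β) {k : ℕ}
    (hk : 1 ≤ k) (hn : (Fintype.card V : ℝ) ≤ β ^ k) :
    ∃ r < k, ((Finset.univ.filter fun z => F.Reachable v z ∧ F.dist v z ≤ r + 1).card : ℝ) ≤
      β * (Finset.univ.filter fun z => F.Reachable v z ∧ F.dist v z ≤ r).card := by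
  by_contra! hcon
  have key : ∀ j ≤ k, β ^ j ≤
      ((Finset.univ.filter fun z => F.Reachable v z ∧ F.dist v z ≤ j).card : ℝ) ∧
      (0 < j → β ^ j <
      ((Finset.univ.filter fun z => F.Reachable v z ∧ F.dist v z ≤ j).card : ℝ)) := by
    intro j
    induction j with
    | zero =>
      intro _
      refine ⟨?_, by simp⟩
      have : 0 < (Finset.univ.filter fun z => F.Reachable v z ∧ F.dist v z ≤ 0).card :=
        Finset.card_pos.2 ⟨v, by simp⟩
      simpa using this
    | succ j ih =>
      intro hj
      have h1 := (ih (by omega)).1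
      have h2 := hcon j (by omega)
      have h3 : β ^ (j + 1) <
          ((Finset.univ.filter fun z => F.Reachable v z ∧ F.dist v z ≤ j + 1).card : ℝ) := by
        calc β ^ (j + 1) = β * β ^ j := by ring
          _ ≤ _ := mul_le_mul_of_nonneg_left h1 (by linarith)
          _ < _ := h2
      exact ⟨h3.le, fun _ => h3⟩
  have h1 := (key k le_rfl).2 hk
  have h2 : ((Finset.univ.filter fun z => F.Reachable v z ∧ F.dist v z ≤ k).card : ℝ) ≤
      Fintype.card V := by exact_mod_cast Finset.card_le_univ _
  linarith

open Classical in
/-- A graph with long detours becomes a forest after deleting few edges: balls of small radius in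
it are trees, and they can be cut out along small boundaries. -/
theorem LongDetours.exists_isLayered [Fintype V] {l k : ℕ} {β : ℝ} (hβ : 1 ≤ β)
    (hk : 1 ≤ k) (hkl : 2 * k ≤ l) (hn : (Fintype.card V : ℝ) ≤ β ^ k) (W : Finset V)
    {F : SimpleGraph V} (hW : ∀ a b, F.Adj a b → a ∈ W) (hF : LongDetours F l) :
    ∃ A ≤ F, ∃ ρ, IsLayered A ρ ∧ ((F.edgeSet \ A.edgeSet).ncard : ℝ) ≤ (β - 1) * W.card := by
  obtain ⟨n, hWn⟩ : ∃ n, W.card = n := ⟨_, rfl⟩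
  induction n using Nat.strong_induction_on generalizing W F with
  | _ n ih =>
    rcases W.eq_empty_or_nonempty with rfl | ⟨v, hv⟩
    · refine ⟨F, le_rfl, fun _ => 0, ⟨fun y x h => ?_, fun y x _ h => ?_⟩, by simp⟩ <;>
      exact absurd (hW _ _ h) (by simp)
    obtain ⟨r, hr, hball⟩ := exists_ball_card_le F v hβ hk hn
    set B := Finset.univ.filter fun z => F.Reachable v z ∧ F.dist v z ≤ r with hB
    set B' := Finset.univ.filter fun z => F.Reachable v z ∧ F.dist v z ≤ r + 1 with hB'
    have memB : ∀ z, z ∈ B ↔ F.Reachable v z ∧ F.dist v z ≤ r := by simp [hB]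
    have memB' : ∀ z, z ∈ B' ↔ F.Reachable v z ∧ F.dist v z ≤ r + 1 := by simp [hB']
    have hBB' : B ⊆ B' := fun z hz => (memB' z).2 ⟨((memB z).1 hz).1, by
      have := ((memB z).1 hz).2; omega⟩
    have hBW : B ⊆ W := by
      intro z hz
      obtain ⟨⟨p⟩, -⟩ := (memB z).1 hz
      have : ∀ {a b} (p : F.Walk a b), a ∈ W → b ∈ W := by
        intro a b p
        induction p with
        | nil => exact id
        | cons h p ih => exact fun _ => ih (hW _ _ h.symm)
      exact this p hv
    have hvB : v ∈ B := by simp [hB]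
    let F' : SimpleGraph V :=
      { Adj := fun a b => F.Adj a b ∧ a ∉ B ∧ b ∉ B
        symm := ⟨fun a b h => ⟨h.1.symm, h.2.2, h.2.1⟩⟩
        loopless := ⟨fun a h => h.1.ne rfl⟩ }
    have hF'F : F' ≤ F := fun a b h => h.1
    have hcard : (W \ B).card + B.card = W.card := Finset.card_sdiff_add_card_eq_card hBW
    have hBpos : 0 < B.card := Finset.card_pos.2 ⟨v, hvB⟩
    obtain ⟨A', hA', ρ', hρ', hA'c⟩ := ih (W \ B).card (by omega) (W \ B) (F := F')
      (fun a b h => Finset.mem_sdiff.2 ⟨hW a b h.1, h.2.1⟩) (hF.mono hF'F) rfl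
    let A : SimpleGraph V :=
      { Adj := fun a b => A'.Adj a b ∨ (F.Adj a b ∧ a ∈ B ∧ b ∈ B)
        symm := ⟨fun a b h => h.imp (fun h => h.symm) fun h => ⟨h.1.symm, h.2.2, h.2.1⟩⟩
        loopless := ⟨fun a h => h.elim (fun h => h.ne rfl) fun h => h.1.ne rfl⟩ }
    refine ⟨A, ?_, fun z => if z ∈ B then F.dist v z else ρ' z, ⟨?_, ?_⟩, ?_⟩
    · rintro a b (h | h)
      · exact (hA' h).1
      · exact h.1
    · rintro y x (h | h)
      · simpa [(hA' h).2.1, (hA' h).2.2] using hρ'.ne y x h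
      · obtain ⟨h1, h2⟩ := (memB y).1 h.2.1
        simpa [h.2.1, h.2.2] using hF.dist_ne h1 h.1 (by omega)
    · rintro y x x' (h | h) (h' | h') hlt hlt'
      · simp only [(hA' h).2.1, (hA' h).2.2, (hA' h').2.2, if_false] at hlt hlt'
        exact hρ'.parent_unique y x x' h h' hlt hlt'
      · exact absurd h'.2.1 (hA' h).2.1
      · exact absurd h.2.1 (hA' h').2.1
      · simp only [h.2.1, h.2.2, h'.2.2, if_true] at hlt hlt'
        obtain ⟨h1, h2⟩ := (memB y).1 h.2.1
        exact hF.eq_of_dist_lt h1 h.1 h'.1 hlt hlt' (by omega)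
    · -- Edges leaving the ball are determined by their endpoint in the next sphere.
      have hleave : ∀ a b, F.Adj a b → a ∈ B → b ∉ B →
          b ∈ B' \ B ∧ F.dist v a < F.dist v b := by
        intro a b hab ha hb
        obtain ⟨h1, h2⟩ := (memB a).1 ha
        have h3 := h1.trans hab.reachable
        have h4 : F.dist v b ≤ F.dist v a + 1 := by
          obtain ⟨p, hp⟩ := h1.exists_walk_length_eq_dist
          have := dist_le (p.concat hab)
          rwa [Walk.length_concat, hp] at this
        have h5 : ¬ F.dist v b ≤ r := fun h => hb ((memB b).2 ⟨h3, h⟩)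
        exact ⟨Finset.mem_sdiff.2 ⟨(memB' b).2 ⟨h3, by omega⟩, hb⟩, by omega⟩
      choose! f hf using fun (b : V) (hb : ∃ a, F.Adj a b ∧ a ∈ B ∧ b ∉ B) => hb
      have hsub : F.edgeSet \ A.edgeSet ⊆
          ((fun b => s(f b, b)) '' (B' \ B : Finset V)) ∪ (F'.edgeSet \ A'.edgeSet) := by
        rintro e ⟨he, heA⟩
        have hcross : ∀ a b, F.Adj a b → a ∈ B → b ∉ B →
            s(a, b) ∈ (fun b => s(f b, b)) '' (B' \ B : Finset V) := by
          intro a b hab ha hb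
          have h1 := hleave a b hab ha hb
          have h2 := hf b ⟨a, hab, ha, hb⟩
          have h3 := hleave _ b h2.1 h2.2.1 hb
          have h4 := (memB' b).1 (Finset.mem_sdiff.1 h1.1).1
          refine ⟨b, h1.1, ?_⟩
          simp only [hF.eq_of_dist_lt h4.1 h2.1.symm hab.symm h3.2 h1.2 (by omega)]
        induction e with | _ a b
        have hab : F.Adj a b := he
        by_cases ha : a ∈ B <;> by_cases hb : b ∈ B
        · exact absurd (show A.Adj a b from .inr ⟨hab, ha, hb⟩) heA
        · exact .inl (hcross a b hab ha hb)
        · exact .inl (Sym2.eq_swap ▸ hcross b a hab.symm hb ha)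
        · exact .inr ⟨⟨hab, ha, hb⟩, fun h => heA (show A.Adj a b from .inl h)⟩
      have h1 : (F.edgeSet \ A.edgeSet).ncard ≤
          (B' \ B).card + (F'.edgeSet \ A'.edgeSet).ncard := by
        refine (Set.ncard_le_ncard hsub (Set.toFinite _)).trans
          ((Set.ncard_union_le _ _).trans (Nat.add_le_add_right ?_ _))
        exact (Set.ncard_image_le (Set.toFinite _)).trans (Set.ncard_coe_finset _).le
      have h2 : (B' \ B).card + B.card = B'.card := Finset.card_sdiff_add_card_eq_card hBB'
      have h1' : ((F.edgeSet \ A.edgeSet).ncard : ℝ) ≤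
          (B' \ B).card + (F'.edgeSet \ A'.edgeSet).ncard := by exact_mod_cast h1
      have h2' : ((B' \ B).card : ℝ) + B.card = B'.card := by exact_mod_cast h2
      have h3' : ((W \ B).card : ℝ) + B.card = W.card := by exact_mod_cast hcard
      rw [← h3']
      linarith

/-- With `n ≤ β ^ k`, balls of radius at most `k` cannot keep growing by the factor `β`; the excess
is at most the number of edges between the balls cut out, which is at most `(β - 1) * n`. -/
theorem excess_le_mul_card [Finite V] {l k : ℕ} {β : ℝ} (hβ : 1 ≤ β) (hk : 1 ≤ k)
    (hkl : 2 * k ≤ l) (hn : (Nat.card V : ℝ) ≤ β ^ k) (H : SimpleGraph V) :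
    (excess l H : ℝ) ≤ (β - 1) * Nat.card V := by
  classical
  have := Fintype.ofFinite V
  obtain ⟨F, hFH, hF, e⟩ := exists_ncard_eq_maxSparse l H
  rw [Nat.card_eq_fintype_card] at hn
  obtain ⟨A, hAF, ρ, hρ, hA⟩ := hF.exists_isLayered hβ hk hkl hn Finset.univ (by simp)
  have h1 := hρ.ncard_add_card_component_le
  have h2 := ConnectedComponent.card_le_card_of_le (hAF.trans hFH)
  have h3 : (F.edgeSet \ A.edgeSet).ncard + A.edgeSet.ncard = F.edgeSet.ncard :=
    Set.ncard_sdiff_add_ncard_of_subset (edgeSet_subset_edgeSet.2 hAF) (Set.toFinite _)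
  have h4 : excess l H ≤ (F.edgeSet \ A.edgeSet).ncard := by
    unfold excess
    omega
  rw [Nat.card_eq_fintype_card]
  exact le_trans (by exact_mod_cast h4) hA

theorem excess_le_ncard [Finite V] (l : ℕ) (H : SimpleGraph V) :
    excess l H ≤ H.edgeSet.ncard := by
  obtain ⟨F, hFH, -, e⟩ := exists_ncard_eq_maxSparse l H
  have h1 := Set.ncard_le_ncard (edgeSet_subset_edgeSet.2 hFH) (Set.toFinite _)
  have h2 : Nat.card H.ConnectedComponent ≤ Nat.card V :=
    Nat.card_le_card_of_surjective H.connectedComponentMk fun C => C.exists_rep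
  unfold excess
  omega

end BallGrowing

/-! ### Summing the excess over all detour lengths -/

section Estimates

theorem one_le_log_of_three_le {n : ℕ} (hn : 3 ≤ n) : 1 ≤ Real.log n := by
  rw [Real.le_log_iff_exp_le (by positivity)]
  have h1 := Real.exp_one_lt_d9
  have h2 : (3 : ℝ) ≤ n := by exact_mod_cast hn
  linarith

theorem one_le_eps_denom {n m : ℕ} (hn : 3 ≤ n) (hm : n ≤ m) :
    1 ≤ 1 + Real.log m - Real.log n := by
  have : Real.log n ≤ Real.log m :=
    Real.log_le_log (by positivity) (by exact_mod_cast hm)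
  linarith

theorem half_le_eps {n m : ℕ} (hn : 3 ≤ n) (hm : n ≤ m) (hm' : m ≤ n.choose 2) :
    1 / 2 ≤ eps n m := by
  have hL := one_le_log_of_three_le hn
  have ha := one_le_eps_denom hn hm
  have h1 : m ≤ n ^ 2 := hm'.trans (Nat.choose_le_pow n 2)
  have h2 : Real.log m ≤ 2 * Real.log n := by
    have : Real.log m ≤ Real.log ((n : ℝ) ^ 2) :=
      Real.log_le_log (by norm_cast; omega) (by exact_mod_cast h1)
    rwa [Real.log_pow] at this
  unfold eps
  rw [le_div_iff₀ (by linarith)]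
  linarith

variable {V : Type*} [Finite V]

/-- The three ranges of detour lengths: up to `6 ε` the trivial bound `m` is used; then, with
`β = exp (ln n / (l / 2))` in `excess_le_mul_card`, the bound is `n * (exp (3 ln n / l) - 1)`, which
is crudely estimated up to `3 ln n` and linearised beyond. -/
theorem excess_le {n m : ℕ} (hn : 3 ≤ n) (hm : n ≤ m) (hm' : m ≤ n.choose 2)
    (hV : Nat.card V = n) (H : SimpleGraph V) (hH : H.edgeSet.ncard ≤ m) {l : ℕ} (hl : 1 ≤ l) :
    (excess l H : ℝ) ≤ (if (l : ℝ) ≤ 6 * eps n m then (m : ℝ) else 0) +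
      (if (l : ℝ) ≤ 3 * Real.log n then
        n * Real.exp ((1 + Real.log m - Real.log n) / 2) else 0) +
      6 * n * Real.log n * (l : ℝ)⁻¹ := by
  have hL := one_le_log_of_three_le hn
  have ha := one_le_eps_denom hn hm
  have heps := half_le_eps hn hm hm'
  have hl0 : (0 : ℝ) < l := by exact_mod_cast hl
  have h3 : 0 ≤ 6 * n * Real.log n * (l : ℝ)⁻¹ := by positivity
  have h2 : 0 ≤ if (l : ℝ) ≤ 3 * Real.log n then
      n * Real.exp ((1 + Real.log m - Real.log n) / 2) else 0 := by
    split_ifs <;> positivity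
  by_cases hl1 : (l : ℝ) ≤ 6 * eps n m
  · rw [if_pos hl1]
    have : (excess l H : ℝ) ≤ m := by exact_mod_cast (excess_le_ncard l H).trans hH
    linarith
  rw [if_neg hl1]
  push Not at hl1
  have hl2 : 2 ≤ l := by
    have : (2 : ℝ) ≤ l := by linarith
    exact_mod_cast this
  obtain ⟨k, hk⟩ : ∃ k, k = l / 2 := ⟨_, rfl⟩
  have hk1 : 1 ≤ k := by omega
  have hk0 : (0 : ℝ) < k := by exact_mod_cast hk1
  have hk3 : (l : ℝ) ≤ 3 * k := by
    have : l ≤ 3 * k := by omega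
    exact_mod_cast this
  -- The factor of growth which is impossible for balls of radius up to `l / 2`.
  have hb := excess_le_mul_card (l := l) (k := k) (β := Real.exp (Real.log n / k))
    (Real.one_le_exp (by positivity)) hk1 (by omega) (by
      rw [← Real.exp_nat_mul, mul_div_cancel₀ _ hk0.ne', Real.exp_log (by positivity), hV]) H
  rw [hV] at hb
  have hx : Real.log n / k ≤ 3 * Real.log n / l := by
    rw [div_le_div_iff₀ hk0 hl0]
    nlinarith
  have hx2 : 3 * Real.log n / l ≤ (1 + Real.log m - Real.log n) / 2 := by
    unfold eps at hl1
    rw [← mul_div_assoc, div_lt_iff₀ (by linarith)] at hl1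
    rw [div_le_div_iff₀ hl0 (by norm_num)]
    linarith
  have hn0 : (0 : ℝ) ≤ n := by positivity
  by_cases hl3 : (l : ℝ) ≤ 3 * Real.log n
  · rw [if_pos hl3]
    have : Real.exp (Real.log n / k) ≤ Real.exp ((1 + Real.log m - Real.log n) / 2) :=
      Real.exp_le_exp.2 (hx.trans hx2)
    nlinarith
  · rw [if_neg hl3]
    push Not at hl3
    have hx1 : 3 * Real.log n / l ≤ 1 := by
      rw [div_le_one hl0]; exact hl3.le
    have hpos : 0 ≤ 3 * Real.log n / l := by positivity
    have h4 := Real.abs_exp_sub_one_le (x := 3 * Real.log n / l) (by rwa [abs_of_nonneg hpos])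
    rw [abs_of_nonneg hpos] at h4
    have h5 := (le_abs_self _).trans h4
    have h6 := Real.exp_le_exp.2 hx
    calc (excess l H : ℝ) ≤ _ := hb
      _ ≤ (2 * (3 * Real.log n / l)) * n :=
          mul_le_mul_of_nonneg_right (by linarith) hn0
      _ = _ := by field_simp; ring

theorem sum_ite_le (n : ℕ) {c a : ℝ} (hc : 0 ≤ c) (ha : 0 ≤ a) :
    ∑ l ∈ Finset.Icc 1 n, (if (l : ℝ) ≤ c then a else 0) ≤ c * a := by
  rw [← Finset.sum_filter, Finset.sum_const, nsmul_eq_mul]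
  refine mul_le_mul_of_nonneg_right ?_ ha
  have : (Finset.Icc 1 n).filter (fun l : ℕ => (l : ℝ) ≤ c) ⊆ Finset.Icc 1 ⌊c⌋₊ := by
    intro l hl
    simp only [Finset.mem_filter, Finset.mem_Icc] at hl ⊢
    exact ⟨hl.1.1, Nat.le_floor hl.2⟩
  have h := Finset.card_le_card this
  rw [Nat.card_Icc, Nat.add_sub_cancel] at h
  exact (Nat.cast_le.2 h).trans (Nat.floor_le hc)

theorem totalExcess_le {n m : ℕ} (hn : 3 ≤ n) (hm : n ≤ m) (hm' : m ≤ n.choose 2)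
    (hV : Nat.card V = n) (H : SimpleGraph V) (hH : H.edgeSet.ncard ≤ m) :
    (totalExcess H : ℝ) ≤ 12 * (eps n m * m + n * Real.log n ^ 2) := by
  have hL := one_le_log_of_three_le hn
  have ha := one_le_eps_denom hn hm
  have heps := half_le_eps hn hm hm'
  have hn0 : (0 : ℝ) < n := by positivity
  have hm0 : (0 : ℝ) < m := by norm_cast; omega
  have h1 : (totalExcess H : ℝ) ≤ 6 * eps n m * m +
      3 * Real.log n * (n * Real.exp ((1 + Real.log m - Real.log n) / 2)) +
      6 * n * Real.log n * (1 + Real.log n) := by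
    unfold totalExcess
    rw [hV, Nat.cast_sum]
    refine (Finset.sum_le_sum fun l hl =>
      excess_le hn hm hm' hV H hH (Finset.mem_Icc.1 hl).1).trans ?_
    rw [Finset.sum_add_distrib, Finset.sum_add_distrib, ← Finset.mul_sum]
    refine add_le_add (add_le_add (sum_ite_le n (by positivity) hm0.le)
      (sum_ite_le n (by positivity) (by positivity))) ?_
    refine mul_le_mul_of_nonneg_left ?_ (by positivity)
    have := harmonic_le_one_add_log n
    rw [harmonic_eq_sum_Icc] at this
    push_cast at this
    exact this
  -- The middle range is absorbed because `a * exp (a / 2) ≤ 2 * exp (a - 1)`.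
  have h2 : 3 * Real.log n * (n * Real.exp ((1 + Real.log m - Real.log n) / 2)) ≤
      6 * (eps n m * m) := by
    have e1 : eps n m = Real.log n / (1 + Real.log m - Real.log n) := rfl
    have e2 : (m : ℝ) = n * Real.exp (Real.log m - Real.log n) := by
      rw [Real.exp_sub, Real.exp_log hm0, Real.exp_log hn0]
      field_simp
    obtain ⟨a, hadef⟩ : ∃ a, a = 1 + Real.log m - Real.log n := ⟨_, rfl⟩
    have e3 : Real.log m - Real.log n = a - 1 := by rw [hadef]; ring
    rw [← hadef] at ha
    have h3 : a ≤ 2 * Real.exp (a / 2 - 1) := by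
      have := Real.add_one_le_exp (a / 2 - 1)
      linarith
    have h4 : Real.exp (a - 1) = Real.exp (a / 2) * Real.exp (a / 2 - 1) := by
      rw [← Real.exp_add]; congr 1; ring
    have h5 : a * Real.exp (a / 2) ≤ 2 * Real.exp (a - 1) := by
      rw [h4]
      nlinarith [Real.exp_pos (a / 2)]
    have h6 : eps n m * m = Real.log n * n * (Real.exp (a - 1) / a) := by
      rw [e1, ← hadef]
      conv_lhs => rw [e2, e3]
      ring
    have h7 : Real.exp (a / 2) ≤ 2 * (Real.exp (a - 1) / a) := by
      rw [← mul_div_assoc, le_div_iff₀ (by linarith)]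
      linarith
    rw [h6, ← hadef]
    have h8 : 0 ≤ Real.log n * n := by positivity
    nlinarith
  have h3 : 6 * n * Real.log n * (1 + Real.log n) ≤ 12 * (n * Real.log n ^ 2) := by
    have : (0 : ℝ) ≤ n * Real.log n := by positivity
    nlinarith
  linarith

end Estimates

/-! ### The algorithm -/

section Exploration

/-- What the agent remembers. Everything is expressed by node labels and ports. -/
structure Memory where
  /-- The traversed edges: `(a, p, b)` means that port `p` of `a` leads to `b`. -/
  known : Set (ℕ × ℕ × ℕ)
  /-- The graph of the known edges that were never seen to be absent in the current phase. -/
  surv : SimpleGraph ℕ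
  /-- All nodes visited so far. -/
  seen : Set ℕ
  /-- The nodes visited in the current phase. -/
  done : Set ℕ
  /-- The current node. -/
  cur : ℕ
  /-- The ports of the current node that are available now. -/
  avail : Finset ℕ

/-- The graph of the known edges. -/
def knownGraph (known : Set (ℕ × ℕ × ℕ)) : SimpleGraph ℕ :=
  .fromRel fun a b => ∃ p, (a, p, b) ∈ known

/-- Delete from `S` the edges at the node `c` that do not use an available port. -/
def pruneLabels (known : Set (ℕ × ℕ × ℕ)) (S : SimpleGraph ℕ) (c : ℕ) (avail : Finset ℕ) :
    SimpleGraph ℕ where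
  Adj a b := S.Adj a b ∧ (a = c → ∃ p ∈ avail, (a, p, b) ∈ known) ∧
    (b = c → ∃ p ∈ avail, (b, p, a) ∈ known)
  symm := ⟨fun _ _ h => ⟨h.1.symm, h.2.2, h.2.1⟩⟩
  loopless := ⟨fun _ h => h.1.ne rfl⟩

/-- Update the memory when a node is entered and `o` is observed there. -/
def arrive (known : Set (ℕ × ℕ × ℕ)) (surv : SimpleGraph ℕ) (seen done : Set ℕ) (o : Obs) :
    Memory where
  known := known
  surv := pruneLabels known surv o.id o.ports
  seen := insert o.id seen
  done := insert o.id done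
  cur := o.id
  avail := o.ports

open Classical in
/-- The decision of the agent: terminate if `n` nodes have been seen; otherwise leave through an
unknown port if one is available; otherwise follow a shortest walk in the surviving known graph that
covers all reachable nodes not yet visited in the current phase. -/
noncomputable def Memory.next (n : ℕ) (σ : Memory) : Option ℕ :=
  if σ.seen.ncard = n then none
  else if h : ∃ p ∈ σ.avail, ∀ b, (σ.cur, p, b) ∉ σ.known then some h.choose
  else if h : ∃ p b k, (σ.cur, p, b) ∈ σ.known ∧ σ.surv.Adj σ.cur b ∧ Covers σ.surv σ.doneᶜ b k ∧
    ∀ j, Covers σ.surv σ.doneᶜ σ.cur j → k < j then some h.choose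
  else none

open Classical in
/-- The new memory after the next observation. The traversal of an unknown edge starts a new phase.
An observation without incoming port is the first one, which initialises the memory. -/
noncomputable def Memory.absorb (n : ℕ) (σ : Memory) (o : Obs) : Memory :=
  match o.pin, σ.next n with
  | some q, some p =>
    if (σ.cur, p, o.id) ∈ σ.known then arrive σ.known σ.surv σ.seen σ.done o
    else arrive (σ.known ∪ {(σ.cur, p, o.id), (o.id, q, σ.cur)})
      (knownGraph (σ.known ∪ {(σ.cur, p, o.id), (o.id, q, σ.cur)})) σ.seen ∅ o
  | _, _ => arrive ∅ ⊥ ∅ ∅ o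

/-- The memory after a list of observations. The initial value is irrelevant. -/
noncomputable def memory (n : ℕ) (h : List Obs) : Memory :=
  h.foldl (Memory.absorb n) ⟨∅, ⊥, ∅, ∅, 0, ∅⟩

/-- The exploration algorithm for graphs with `n` nodes. -/
noncomputable def explorer (n : ℕ) : Algorithm := fun h => (memory n h).next n

/-- Delete from `H` the edges at `x` that are not present in `S`. -/
def pruneAt {V : Type*} (H : SimpleGraph V) (x : V) (S : SimpleGraph V) : SimpleGraph V where
  Adj a b := H.Adj a b ∧ (a = x ∨ b = x → S.Adj a b)
  symm := ⟨fun _ _ h => ⟨h.1.symm, fun e => (h.2 e.symm).symm⟩⟩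
  loopless := ⟨fun _ h => h.1.ne rfl⟩

namespace DynGraph

variable {V : Type} [Fintype V] (D : DynGraph V)

/-- The labelling as an embedding. -/
def idEmb : V ↪ ℕ := ⟨D.id, D.id_injective⟩

/-- The set of known edges in terms of labels and ports. -/
def labels (K : SimpleGraph V) : Set (ℕ × ℕ × ℕ) :=
  {e | ∃ u v, K.Adj u v ∧ e = (D.id u, D.port u v, D.id v)}

/-- The memory of an agent at `x` at time `t`, in terms of the nodes of the dynamic graph. -/
noncomputable def encode (K H : SimpleGraph V) (seen done : Set V) (x : V) (t : ℕ) : Memory where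
  known := D.labels K
  surv := H.map D.idEmb
  seen := D.id '' seen
  done := D.id '' done
  cur := D.id x
  avail := (D.nbrs x t).image (D.port x)

variable {D}

theorem port_inj {x u v : V} (hu : D.G.Adj x u) (hv : D.G.Adj x v) (h : D.port x u = D.port x v) :
    u = v :=
  (D.port_bijOn x).injOn hu hv h

theorem mem_nbrs {x v : V} {t : ℕ} : v ∈ D.nbrs x t ↔ (D.snap t).Adj x v := by
  classical
  simp [nbrs]

theorem mem_labels {K : SimpleGraph V} {x b : V} {p : ℕ} :
    (D.id x, p, D.id b) ∈ D.labels K ↔ K.Adj x b ∧ p = D.port x b := by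
  constructor
  · rintro ⟨u, v, h, e⟩
    simp only [Prod.mk.injEq] at e
    obtain ⟨e1, e2, e3⟩ := e
    obtain rfl := D.id_injective e1
    obtain rfl := D.id_injective e3
    exact ⟨h, e2⟩
  · rintro ⟨h, rfl⟩
    exact ⟨x, b, h, rfl⟩

theorem knownGraph_labels (K : SimpleGraph V) : knownGraph (D.labels K) = K.map D.idEmb := by
  ext a b
  rw [knownGraph, fromRel_adj, SimpleGraph.map_adj]
  constructor
  · rintro ⟨-, ⟨p, u, v, h, e⟩ | ⟨p, u, v, h, e⟩⟩
    · simp only [Prod.mk.injEq] at e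
      exact ⟨u, v, h, e.1.symm, e.2.2.symm⟩
    · simp only [Prod.mk.injEq] at e
      exact ⟨v, u, h.symm, e.2.2.symm, e.1.symm⟩
  · rintro ⟨u, v, h, rfl, rfl⟩
    exact ⟨fun e => h.ne (D.id_injective e), .inl ⟨_, u, v, h, rfl⟩⟩

theorem labels_sup_edge {K : SimpleGraph V} {x y : V} (h : x ≠ y) :
    D.labels (K ⊔ edge x y) =
      D.labels K ∪ {(D.id x, D.port x y, D.id y), (D.id y, D.port y x, D.id x)} := by
  ext e
  constructor
  · rintro ⟨u, v, huv | huv, rfl⟩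
    · exact .inl ⟨u, v, huv, rfl⟩
    · rw [edge_adj] at huv
      rcases huv.1 with ⟨rfl, rfl⟩ | ⟨rfl, rfl⟩
      · exact .inr (.inl rfl)
      · exact .inr (.inr rfl)
  · rintro (⟨u, v, huv, rfl⟩ | rfl | rfl)
    · exact ⟨u, v, .inl huv, rfl⟩
    · exact ⟨x, y, .inr (by rw [edge_adj]; exact ⟨.inl ⟨rfl, rfl⟩, h⟩), rfl⟩
    · exact ⟨y, x, .inr (by rw [edge_adj]; exact ⟨.inr ⟨rfl, rfl⟩, h.symm⟩), rfl⟩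

theorem exists_avail_iff {K : SimpleGraph V} (hK : K ≤ D.G) {x v : V} {t : ℕ} (h : K.Adj x v) :
    (∃ p ∈ (D.nbrs x t).image (D.port x), (D.id x, p, D.id v) ∈ D.labels K) ↔
      (D.snap t).Adj x v := by
  constructor
  · rintro ⟨p, hp, hl⟩
    obtain ⟨u, hu, rfl⟩ := Finset.mem_image.1 hp
    rw [mem_nbrs] at hu
    have := (mem_labels.1 hl).2
    rwa [port_inj (D.snap_le t hu) (hK h) this] at hu
  · intro hs
    exact ⟨D.port x v, Finset.mem_image_of_mem _ (mem_nbrs.2 hs), mem_labels.2 ⟨h, rfl⟩⟩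

theorem pruneLabels_map {K H : SimpleGraph V} (hK : K ≤ D.G) (hH : H ≤ K) (x : V) (t : ℕ) :
    pruneLabels (D.labels K) (H.map D.idEmb) (D.id x) ((D.nbrs x t).image (D.port x)) =
      (pruneAt H x (D.snap t)).map D.idEmb := by
  ext a b
  rw [SimpleGraph.map_adj]
  constructor
  · rintro ⟨h, h1, h2⟩
    obtain ⟨u, v, huv, rfl, rfl⟩ := (SimpleGraph.map_adj _ _ _ _).1 h
    refine ⟨u, v, ⟨huv, ?_⟩, rfl, rfl⟩
    rintro (rfl | rfl)
    · exact (exists_avail_iff hK (hH huv)).1 (h1 rfl)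
    · exact ((exists_avail_iff hK (hH huv.symm)).1 (h2 rfl)).symm
  · rintro ⟨u, v, ⟨huv, hs⟩, rfl, rfl⟩
    refine ⟨(SimpleGraph.map_adj _ _ _ _).2 ⟨u, v, huv, rfl, rfl⟩, fun e => ?_, fun e => ?_⟩
    · obtain rfl := D.id_injective e
      exact (exists_avail_iff hK (hH huv)).2 (hs (.inl rfl))
    · obtain rfl := D.id_injective e
      exact (exists_avail_iff hK (hH huv.symm)).2 (hs (.inr rfl)).symm

theorem arrive_encode {K H : SimpleGraph V} (hK : K ≤ D.G) (hH : H ≤ K) (seen done : Set V)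
    (k : Fin 2) (ν : ℕ → V) (t : ℕ) :
    arrive (D.labels K) (H.map D.idEmb) (D.id '' seen) (D.id '' done) (D.obs k ν t) =
      D.encode K (pruneAt H (ν t) (D.snap t)) (insert (ν t) seen) (insert (ν t) done) (ν t) t := by
  unfold arrive encode
  simp only [obs, Set.image_insert_eq, Memory.mk.injEq, and_true, true_and]
  exact pruneLabels_map hK hH (ν t) t

theorem absorb_start (n : ℕ) (σ : Memory) (k : Fin 2) (ν : ℕ → V) :
    σ.absorb n (D.obs k ν 0) =
      D.encode ⊥ (pruneAt ⊥ (ν 0) (D.snap 0)) (insert (ν 0) ∅) (insert (ν 0) ∅) (ν 0) 0 := by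
  have h : D.labels ⊥ = ∅ := by
    ext e
    simp [labels]
  have := arrive_encode (D := D) (K := ⊥) (H := ⊥) bot_le le_rfl ∅ ∅ k ν 0
  have hb : (⊥ : SimpleGraph V).map D.idEmb = ⊥ := by
    ext a b
    simp [SimpleGraph.map_adj]
  rw [← this, h, Set.image_empty, hb]
  rfl

theorem absorb_known {n : ℕ} {K H : SimpleGraph V} (hK : K ≤ D.G) (hH : H ≤ K) {seen done : Set V}
    {k : Fin 2} {ν : ℕ → V} {t : ℕ} (h : K.Adj (ν t) (ν (t + 1)))
    (hn : (D.encode K H seen done (ν t) t).next n = some (D.port (ν t) (ν (t + 1)))) :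
    (D.encode K H seen done (ν t) t).absorb n (D.obs k ν (t + 1)) =
      D.encode K (pruneAt H (ν (t + 1)) (D.snap (t + 1))) (insert (ν (t + 1)) seen)
        (insert (ν (t + 1)) done) (ν (t + 1)) (t + 1) := by
  rw [← arrive_encode hK hH seen done k ν (t + 1)]
  have hp : (D.obs k ν (t + 1)).pin = some (D.port (ν (t + 1)) (ν t)) := rfl
  unfold Memory.absorb
  rw [hn, hp]
  exact if_pos (mem_labels.2 ⟨h, rfl⟩)

theorem absorb_new {n : ℕ} {K H : SimpleGraph V} (hK : K ≤ D.G) {seen done : Set V}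
    {k : Fin 2} {ν : ℕ → V} {t : ℕ} (h : ¬ K.Adj (ν t) (ν (t + 1)))
    (hG : D.G.Adj (ν t) (ν (t + 1)))
    (hn : (D.encode K H seen done (ν t) t).next n = some (D.port (ν t) (ν (t + 1)))) :
    (D.encode K H seen done (ν t) t).absorb n (D.obs k ν (t + 1)) =
      D.encode (K ⊔ edge (ν t) (ν (t + 1)))
        (pruneAt (K ⊔ edge (ν t) (ν (t + 1))) (ν (t + 1)) (D.snap (t + 1)))
        (insert (ν (t + 1)) seen) (insert (ν (t + 1)) ∅) (ν (t + 1)) (t + 1) := by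
  rw [← arrive_encode (sup_le hK (by rw [edge_le_iff]; exact .inr hG)) le_rfl seen ∅ k ν (t + 1),
    ← knownGraph_labels, labels_sup_edge hG.ne, Set.image_empty]
  have hp : (D.obs k ν (t + 1)).pin = some (D.port (ν (t + 1)) (ν t)) := rfl
  unfold Memory.absorb
  rw [hn, hp]
  exact if_neg fun h' => h (mem_labels.1 h').1

theorem ncard_image_id (s : Set V) : (D.id '' s).ncard = s.ncard :=
  Set.ncard_image_of_injective s D.id_injective

theorem next_eq_none (K H : SimpleGraph V) (done : Set V) (x : V) (t : ℕ) :
    (D.encode K H Set.univ done x t).next (Fintype.card V) = none := by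
  unfold Memory.next
  rw [if_pos]
  rw [← Nat.card_eq_fintype_card, ← Set.ncard_univ]
  exact ncard_image_id _

theorem ncard_seen_ne {K H : SimpleGraph V} {seen done : Set V} {x : V} {t : ℕ}
    (hs : seen ≠ Set.univ) : (D.encode K H seen done x t).seen.ncard ≠ Fintype.card V := by
  intro h
  have h' : (D.id '' seen).ncard = Fintype.card V := h
  rw [ncard_image_id, ← Nat.card_eq_fintype_card] at h'
  exact hs (Set.eq_univ_iff_ncard seen |>.2 h')

theorem unknown_port_iff {K : SimpleGraph V} (hK : K ≤ D.G) {x v : V} (h : D.G.Adj x v) :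
    (∀ b, (D.id x, D.port x v, b) ∉ D.labels K) ↔ ¬ K.Adj x v := by
  constructor
  · exact fun h1 h2 => h1 _ (mem_labels.2 ⟨h2, rfl⟩)
  · rintro h1 b ⟨u, w, h2, e⟩
    simp only [Prod.mk.injEq] at e
    obtain rfl := D.id_injective e.1
    exact h1 (port_inj h (hK h2) e.2.1 ▸ h2)

theorem next_new {K H : SimpleGraph V} (hK : K ≤ D.G) {seen done : Set V} {x : V} {t : ℕ}
    (hs : seen ≠ Set.univ) (h : ∃ v, (D.snap t).Adj x v ∧ ¬ K.Adj x v) :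
    ∃ v, (D.snap t).Adj x v ∧ ¬ K.Adj x v ∧
      (D.encode K H seen done x t).next (Fintype.card V) = some (D.port x v) := by
  have hex : ∃ p ∈ (D.encode K H seen done x t).avail,
      ∀ b, ((D.encode K H seen done x t).cur, p, b) ∉ (D.encode K H seen done x t).known := by
    obtain ⟨v, h1, h2⟩ := h
    exact ⟨D.port x v, Finset.mem_image_of_mem _ (mem_nbrs.2 h1),
      (unknown_port_iff hK (D.snap_le t h1)).2 h2⟩
  obtain ⟨h1, h2⟩ := hex.choose_spec
  obtain ⟨v, hv, e⟩ := Finset.mem_image.1 h1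
  rw [mem_nbrs] at hv
  rw [← e] at h2
  refine ⟨v, hv, (unknown_port_iff hK (D.snap_le t hv)).1 h2, ?_⟩
  unfold Memory.next
  rw [if_neg (ncard_seen_ne hs), dif_pos hex, e]

theorem next_old {K H : SimpleGraph V} (hK : K ≤ D.G) (hH : H ≤ K) {seen done : Set V} {x : V}
    {t : ℕ} (hs : seen ≠ Set.univ) (h : ¬ ∃ v, (D.snap t).Adj x v ∧ ¬ K.Adj x v)
    (hc : ∃ w k, H.Adj x w ∧ Covers H doneᶜ w k ∧ ∀ j, Covers H doneᶜ x j → k < j) :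
    ∃ w k, H.Adj x w ∧ (Covers H doneᶜ w k ∧ ∀ j, Covers H doneᶜ x j → k < j) ∧
      (D.encode K H seen done x t).next (Fintype.card V) = some (D.port x w) := by
  have hcov : ∀ w k, Covers (D.encode K H seen done x t).surv (D.encode K H seen done x t).doneᶜ
      (D.id w) k ↔ Covers H doneᶜ w k := by
    intro w k
    have := covers_map_iff D.idEmb (H := H) (U := (D.id '' done)ᶜ) (x := w) (k := k)
    rw [Set.preimage_compl] at this
    have e : D.idEmb ⁻¹' (D.id '' done) = done := Set.preimage_image_eq _ D.id_injective
    rwa [e] at this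
  have hnex : ¬ ∃ p ∈ (D.encode K H seen done x t).avail,
      ∀ b, ((D.encode K H seen done x t).cur, p, b) ∉ (D.encode K H seen done x t).known := by
    rintro ⟨p, h1, h2⟩
    obtain ⟨v, hv, rfl⟩ := Finset.mem_image.1 h1
    rw [mem_nbrs] at hv
    exact h ⟨v, hv, (unknown_port_iff hK (D.snap_le t hv)).1 h2⟩
  have hex : ∃ p b k, ((D.encode K H seen done x t).cur, p, b) ∈
      (D.encode K H seen done x t).known ∧
      (D.encode K H seen done x t).surv.Adj (D.encode K H seen done x t).cur b ∧
      Covers (D.encode K H seen done x t).surv (D.encode K H seen done x t).doneᶜ b k ∧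
      ∀ j, Covers (D.encode K H seen done x t).surv (D.encode K H seen done x t).doneᶜ
        (D.encode K H seen done x t).cur j → k < j := by
    obtain ⟨w, k, h1, h2, h3⟩ := hc
    exact ⟨D.port x w, D.id w, k, mem_labels.2 ⟨hH h1, rfl⟩,
      (SimpleGraph.map_adj _ _ _ _).2 ⟨x, w, h1, rfl, rfl⟩, (hcov w k).2 h2,
      fun j hj => h3 j ((hcov x j).1 hj)⟩
  obtain ⟨b, k, h1, h2, h3, h4⟩ := hex.choose_spec
  obtain ⟨x', w, hxw, e1, rfl⟩ := (SimpleGraph.map_adj _ _ _ _).1 h2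
  obtain rfl := D.id_injective e1
  refine ⟨w, k, hxw, ⟨(hcov w k).1 h3, fun j hj => h4 j ((hcov _ j).2 hj)⟩, ?_⟩
  unfold Memory.next
  rw [if_neg (ncard_seen_ne hs), dif_neg hnex, dif_pos hex]
  exact congrArg some (mem_labels.1 h1).2

/-! ### Correctness of the algorithm -/

/-- The state of the exploration at time `t` in the phase that began at time `t₀`: `K` is the graph
of the known edges, `H` that of the known edges not seen to be absent in this phase, `done` the set
of nodes visited in this phase. By `time` the phase ends in success before the window
`{t₀, …, t₀ + T - 1}` does. -/
structure Phase (D : DynGraph V) (k : Fin 2) (T : ℕ) (ν : ℕ → V) (t t₀ : ℕ)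
    (K H : SimpleGraph V) (seen done : Set V) : Prop where
  mem : memory (Fintype.card V) (D.history k ν t) = D.encode K H seen done (ν t) t
  seen_subset : ∀ v ∈ seen, ∃ i ≤ t, ν i = v
  done_subset : done ⊆ seen
  cur_mem : ν t ∈ done
  known_le : K ≤ D.G
  surv_le : H ≤ K
  stable : ∀ u v, K.Adj u v → (∀ i, t₀ ≤ i → i ≤ t → (D.snap i).Adj u v) → H.Adj u v
  done_ports : ∀ u ∈ done, u ≠ ν t → ∀ v, (∀ i, t₀ ≤ i → i ≤ t → (D.snap i).Adj u v) → K.Adj u v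
  here : ∀ v, H.Adj (ν t) v → (D.snap t).Adj (ν t) v
  start_le : t₀ ≤ t
  time : ∃ j, Covers H doneᶜ (ν t) j ∧ t + j + 2 * totalExcess H < t₀ + T

/-- On entering a node, the edges found to be absent there are deleted; by the potential argument this
does not endanger the deadline of the phase. -/
theorem Phase.of_arrive {k : Fin 2} {T : ℕ} {ν : ℕ → V} {t t₀ : ℕ} {K H : SimpleGraph V}
    {seen done : Set V}
    (mem : memory (Fintype.card V) (D.history k ν t) =
      D.encode K (pruneAt H (ν t) (D.snap t)) (insert (ν t) seen) (insert (ν t) done) (ν t) t)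
    (seen_subset : ∀ v ∈ seen, ∃ i ≤ t, ν i = v) (done_subset : done ⊆ seen)
    (known_le : K ≤ D.G) (surv_le : H ≤ K)
    (stable : ∀ u v, K.Adj u v → (∀ i, t₀ ≤ i → i < t → (D.snap i).Adj u v) → H.Adj u v)
    (done_ports : ∀ u ∈ done, ∀ v, (∀ i, t₀ ≤ i → i < t → (D.snap i).Adj u v) → K.Adj u v)
    (start_le : t₀ ≤ t)
    (time : ∃ j, Covers H doneᶜ (ν t) j ∧ t + j + 2 * totalExcess H < t₀ + T) :
    D.Phase k T ν t t₀ K (pruneAt H (ν t) (D.snap t)) (insert (ν t) seen) (insert (ν t) done) where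
  mem := mem
  seen_subset := by
    rintro v (rfl | hv)
    · exact ⟨t, le_rfl, rfl⟩
    · exact seen_subset v hv
  done_subset := Set.insert_subset_insert done_subset
  cur_mem := Set.mem_insert _ _
  known_le := known_le
  surv_le := fun _ _ h => surv_le h.1
  stable := fun u v huv hi =>
    ⟨stable u v huv fun i h1 h2 => hi i h1 h2.le, fun _ => hi t start_le le_rfl⟩
  done_ports := by
    rintro u (rfl | hu) hne v hi
    · exact absurd rfl hne
    · exact done_ports u hu v fun i h1 h2 => hi i h1 h2.le
  here := fun v h => h.2 (.inl rfl)
  start_le := start_le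
  time := by
    obtain ⟨j, hc, hj⟩ := time
    obtain ⟨j', hc', hj'⟩ := (hc.mono (Set.compl_subset_compl.2 (Set.subset_insert _ _))
      : Covers H (insert (ν t) done)ᶜ (ν t) j).delete_incident
      (H' := pruneAt H (ν t) (D.snap t)) (fun _ _ h => h.1) (by
        intro a b hab hn
        by_contra hcon
        exact hn ⟨hab, fun h => absurd h hcon⟩)
    exact ⟨j', hc', by omega⟩

/-- If no unknown port is available at the current node, then a node which has not been visited in
this phase is still reachable along surviving edges: otherwise an edge of the stable spanning
subgraph would leave the component of the current node, and it would be known. -/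
theorem Phase.exists_reachable {k : Fin 2} {T : ℕ} {ν : ℕ → V} {t t₀ : ℕ} {K H : SimpleGraph V}
    {seen done : Set V} (h : D.Phase k T ν t t₀ K H seen done) (hT : D.IntervalConnected T)
    (hs : seen ≠ Set.univ) (hold : ¬ ∃ v, (D.snap t).Adj (ν t) v ∧ ¬ K.Adj (ν t) v) :
    ∃ z ∈ doneᶜ, H.Reachable (ν t) z := by
  by_contra! hcon
  obtain ⟨z, hz⟩ := (Set.ne_univ_iff_exists_notMem _).1 hs
  obtain ⟨p⟩ := (hT t₀).preconnected (ν t) z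
  have hlt : t < t₀ + T := by
    obtain ⟨j, -, hj⟩ := h.time
    omega
  have hdone : ∀ v, H.Reachable (ν t) v → v ∈ done := fun v hv => by
    by_contra hv'
    exact hcon v hv' hv
  obtain ⟨d, -, hd1, hd2⟩ := p.exists_boundary_dart {v | H.Reachable (ν t) v} Reachable.rfl
    (fun hr => hz (h.done_subset (hdone z hr)))
  have hst : ∀ i, t₀ ≤ i → i ≤ t → (D.snap i).Adj d.fst d.snd := fun i h1 h2 =>
    (iInf₂_le (f := fun i (_ : i ∈ Set.Ico t₀ (t₀ + T)) => D.snap i) i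
      ⟨h1, by omega⟩ : _ ≤ D.snap i) d.adj
  have hK : K.Adj d.fst d.snd := by
    by_cases e : d.fst = ν t
    · by_contra hn
      exact hold ⟨d.snd, e ▸ hst t h.start_le le_rfl, e ▸ hn⟩
    · exact h.done_ports _ (hdone _ hd1) e _ hst
  exact hd2 (Reachable.trans hd1 (h.stable _ _ hK hst).reachable)

theorem history_succ (k : Fin 2) (ν : ℕ → V) (t : ℕ) :
    D.history k ν (t + 1) = D.history k ν t ++ [D.obs k ν (t + 1)] := by
  unfold history
  rw [List.range_succ, List.map_append, List.map_singleton]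

theorem memory_history_succ (n : ℕ) (k : Fin 2) (ν : ℕ → V) (t : ℕ) :
    memory n (D.history k ν (t + 1)) =
      (memory n (D.history k ν t)).absorb n (D.obs k ν (t + 1)) := by
  rw [history_succ, memory, List.foldl_append]
  rfl

theorem history_congr {k : Fin 2} {ν ν' : ℕ → V} {t : ℕ} (h : ∀ i ≤ t, ν i = ν' i) :
    D.history k ν t = D.history k ν' t := by
  unfold history
  refine List.map_congr_left fun i hi => ?_
  have hi' : i ≤ t := by
    rw [List.mem_range] at hi
    omega
  have hp : D.pin ν i = D.pin ν' i := by
    cases i with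
    | zero => rfl
    | succ i => simp only [pin, h (i + 1) hi', h i (by omega)]
  unfold obs
  rw [h i hi', hp]

theorem exists_covers_time_lt {T : ℕ}
    (hT : ∀ K ≤ D.G, 2 * K.edgeSet.ncard + 2 * totalExcess K < T) {K : SimpleGraph V}
    (hK : K ≤ D.G) (U : Set V) (x : V) (t : ℕ) :
    ∃ j, Covers K U x j ∧ t + j + 2 * totalExcess K < t + T := by
  obtain ⟨j, hj, hc⟩ := exists_covers_le K U x
  have := hT K hK
  exact ⟨j, hc, by omega⟩

/-- One step of the exploration: either a new edge becomes known, or the phase continues. -/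
theorem Phase.exists_step {k : Fin 2} {T : ℕ} {ν : ℕ → V} {t t₀ : ℕ} {K H : SimpleGraph V}
    {seen done : Set V} (h : D.Phase k T ν t t₀ K H seen done) (hcon : D.IntervalConnected T)
    (hT : ∀ K ≤ D.G, 2 * K.edgeSet.ncard + 2 * totalExcess K < T) (hs : seen ≠ Set.univ) :
    ∃ y, (D.snap t).Adj (ν t) y ∧
      explorer (Fintype.card V) (D.history k ν t) = some (D.port (ν t) y) ∧
      ∀ ν' : ℕ → V, (∀ i ≤ t, ν i = ν' i) → ν' (t + 1) = y →
        ∃ t₀' K' H' seen' done', D.Phase k T ν' (t + 1) t₀' K' H' seen' done' ∧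
          (K < K' ∨ (K' = K ∧ t₀' = t₀)) := by
  have hexp : ∀ y, (D.encode K H seen done (ν t) t).next (Fintype.card V) =
      some (D.port (ν t) y) →
      explorer (Fintype.card V) (D.history k ν t) = some (D.port (ν t) y) := by
    intro y hy
    rw [explorer, h.mem, hy]
  have hseen : ∀ ν' : ℕ → V, (∀ i ≤ t, ν i = ν' i) → ∀ v ∈ seen, ∃ i ≤ t + 1, ν' i = v := by
    intro ν' hν v hv
    obtain ⟨i, hi, e⟩ := h.seen_subset v hv
    exact ⟨i, by omega, hν i hi ▸ e⟩
  by_cases hnew : ∃ v, (D.snap t).Adj (ν t) v ∧ ¬ K.Adj (ν t) v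
  · obtain ⟨y, h1, h2, h3⟩ := next_new (H := H) (done := done) h.known_le hs hnew
    refine ⟨y, h1, hexp y h3, ?_⟩
    rintro ν' hν rfl
    have hG : D.G.Adj (ν' t) (ν' (t + 1)) := hν t le_rfl ▸ D.snap_le t h1
    have hle : K ⊔ edge (ν' t) (ν' (t + 1)) ≤ D.G :=
      sup_le h.known_le (by rw [edge_le_iff]; exact .inr hG)
    refine ⟨t + 1, K ⊔ edge (ν' t) (ν' (t + 1)), _, _, _,
      Phase.of_arrive (H := K ⊔ edge (ν' t) (ν' (t + 1))) (seen := seen) (done := ∅) ?_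
        (hseen ν' hν) (Set.empty_subset _) hle le_rfl (fun _ _ h _ => h) (by simp) le_rfl
        (exists_covers_time_lt hT hle _ _ _), .inl ?_⟩
    · rw [hν t le_rfl] at h2 h3
      rw [memory_history_succ, ← history_congr hν, h.mem, hν t le_rfl]
      exact absorb_new h.known_le h2 hG h3
    · refine lt_of_le_of_ne le_sup_left fun e => h2 ?_
      rw [e, hν t le_rfl]
      exact .inr (by rw [edge_adj]; exact ⟨.inl ⟨rfl, rfl⟩, hG.ne⟩)
  · obtain ⟨z, hz, hr⟩ := h.exists_reachable hcon hs hnew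
    obtain ⟨j, hj, hjT⟩ := h.time
    obtain ⟨y, j', h1, ⟨h2, h3⟩, h4⟩ := next_old (seen := seen) h.known_le h.surv_le hs hnew
      (exists_adj_covers (fun hx => hx h.cur_mem) hz hr ⟨j, hj⟩)
    have hjj := h3 j hj
    refine ⟨y, h.here y h1, hexp y h4, ?_⟩
    rintro ν' hν rfl
    refine ⟨t₀, K, _, _, _, Phase.of_arrive (H := H) (seen := seen) (done := done) ?_
      (hseen ν' hν) h.done_subset h.known_le h.surv_le
      (fun u v huv hi => h.stable u v huv fun i g1 g2 => hi i g1 (by omega)) ?_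
      (h.start_le.trans (Nat.le_succ t)) ⟨j', h2, by omega⟩, .inr ⟨rfl, rfl⟩⟩
    · rw [memory_history_succ, ← history_congr hν, h.mem, hν t le_rfl]
      rw [hν t le_rfl] at h1 h4
      exact absorb_known h.known_le h.surv_le (h.surv_le h1) h4
    · intro u hu v hi
      by_cases e : u = ν t
      · subst e
        by_contra hn
        exact hnew ⟨v, hi t h.start_le (Nat.lt_succ_self t), hn⟩
      · exact h.done_ports u hu e v fun i g1 g2 => hi i g1 (by omega)

/-- The known edges can become more numerous only finitely often, and a phase lasts less than `T`
steps. -/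
theorem Phase.exploredBy {k : Fin 2} {T : ℕ} (hcon : D.IntervalConnected T)
    (hT : ∀ K ≤ D.G, 2 * K.edgeSet.ncard + 2 * totalExcess K < T) {s : V} (a b : ℕ)
    {ν : ℕ → V} {t t₀ : ℕ} {K H : SimpleGraph V} {seen done : Set V}
    (h : D.Phase k T ν t t₀ K H seen done) (hs : ν 0 = s)
    (hex : ∀ i < t, (D.snap i).Adj (ν i) (ν (i + 1)) ∧
      explorer (Fintype.card V) (D.history k ν i) = some (D.port (ν i) (ν (i + 1))))
    (ha : D.G.edgeSet.ncard - K.edgeSet.ncard = a) (hb : t₀ + T - t = b) :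
    D.ExploredBy k (explorer (Fintype.card V)) s := by
  induction a using Nat.strong_induction_on generalizing b ν t t₀ K H seen done with
  | _ a iha =>
  induction b using Nat.strong_induction_on generalizing ν t t₀ K H seen done with
  | _ b ihb =>
    by_cases hseen : seen = Set.univ
    · subst hseen
      refine ⟨ν, t, ⟨hs, hex, ?_⟩, fun v => h.seen_subset v (Set.mem_univ v)⟩
      rw [explorer, h.mem]
      exact next_eq_none _ _ _ _ _
    · obtain ⟨y, hy, hexp, hstep⟩ := h.exists_step hcon hT hseen
      have hν : ∀ i ≤ t, ν i = Function.update ν (t + 1) y i := fun i hi =>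
        (Function.update_of_ne (by omega) _ _).symm
      obtain ⟨t₀', K', H', seen', done', h', hprog⟩ := hstep (Function.update ν (t + 1) y) hν
        (Function.update_self _ _ _)
      have hs' : Function.update ν (t + 1) y 0 = s := (hν 0 (Nat.zero_le t)).symm.trans hs
      have hex' : ∀ i < t + 1,
          (D.snap i).Adj (Function.update ν (t + 1) y i) (Function.update ν (t + 1) y (i + 1)) ∧
          explorer (Fintype.card V) (D.history k (Function.update ν (t + 1) y) i) =
            some (D.port (Function.update ν (t + 1) y i)
              (Function.update ν (t + 1) y (i + 1))) := by
        intro i hi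
        rw [← history_congr (fun j hj => hν j (by omega)), ← hν i (by omega)]
        rcases Nat.lt_succ_iff_lt_or_eq.1 hi with hi | rfl
        · rw [← hν (i + 1) hi]
          exact hex i hi
        · rw [Function.update_self]
          exact ⟨hy, hexp⟩
      rcases hprog with hK | ⟨rfl, rfl⟩
      · have h1 : K.edgeSet.ncard < K'.edgeSet.ncard :=
          Set.ncard_lt_ncard (edgeSet_strict_mono hK) (Set.toFinite _)
        have h2 : K'.edgeSet.ncard ≤ D.G.edgeSet.ncard :=
          Set.ncard_le_ncard (edgeSet_subset_edgeSet.2 h'.known_le) (Set.toFinite _)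
        exact iha _ (by omega) _ h' hs' hex' rfl rfl
      · have : t < t₀' + T := by
          obtain ⟨j, -, hj⟩ := h.time
          omega
        exact ihb _ (by omega) h' hs' hex' ha rfl

theorem exploredBy_explorer {k : Fin 2} {T : ℕ} (hcon : D.IntervalConnected T)
    (hT : ∀ K ≤ D.G, 2 * K.edgeSet.ncard + 2 * totalExcess K < T) (s : V) :
    D.ExploredBy k (explorer (Fintype.card V)) s := by
  have h : D.Phase k T (fun _ => s) 0 0 ⊥ _ _ _ :=
    Phase.of_arrive (H := ⊥) (seen := ∅) (done := ∅)
      (absorb_start (Fintype.card V) ⟨∅, ⊥, ∅, ∅, 0, ∅⟩ k (fun _ => s)) (by simp) le_rfl bot_le le_rfl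
      (fun _ _ h _ => h) (by simp) le_rfl (exists_covers_time_lt hT bot_le _ _ _)
  exact h.exploredBy hcon hT _ _ rfl (by simp) rfl rfl

end DynGraph

end Exploration

/-- The constant 28 covers the potential at the start of a phase: `2 * m ≤ 4 * (ε * m)` for the
covering walk and twice `12 * (ε * m + n * log² n)` for the total excess. -/
theorem mem_windowSizes {n m : ℕ} (hn : 3 ≤ n) (hm : n ≤ m) (hm' : m ≤ n.choose 2) (k : Fin 2) :
    ⌊28 * (eps n m * m + n * Real.logb 2 n ^ 2)⌋₊ ∈ windowSizes k n m := by
  have hL := one_le_log_of_three_le hn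
  have heps := half_le_eps hn hm hm'
  have hn0 : (3 : ℝ) ≤ n := by exact_mod_cast hn
  have hm0 : (n : ℝ) ≤ m := by exact_mod_cast hm
  have hlog : Real.log n ≤ Real.logb 2 n := by
    rw [Real.logb, le_div_iff₀ (Real.log_pos (by norm_num))]
    have := Real.log_two_lt_d9
    nlinarith
  have h1 : n * Real.log n ^ 2 ≤ n * Real.logb 2 n ^ 2 := by gcongr
  have h2 : (m : ℝ) ≤ 2 * (eps n m * m) := by nlinarith
  have h3 : (3 : ℝ) ≤ n * Real.log n ^ 2 := by nlinarith
  refine ⟨Nat.le_floor (by push_cast; nlinarith), DynExplore.explorer n, ?_⟩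
  intro V _ D hV hE hcon s
  subst hV
  refine DynGraph.exploredBy_explorer hcon (fun K hK => ?_) s
  have hKm : K.edgeSet.ncard ≤ m :=
    hE ▸ Set.ncard_le_ncard (SimpleGraph.edgeSet_subset_edgeSet.2 hK) (Set.toFinite _)
  have h4 := totalExcess_le hn hm hm' Nat.card_eq_fintype_card K hKm
  have h5 : (K.edgeSet.ncard : ℝ) ≤ m := by exact_mod_cast hKm
  refine Nat.lt_of_succ_le (Nat.le_floor ?_)
  push_cast
  nlinarith

end DynExplore

theorem corollary1 :
    ∃ C : ℝ, 0 < C ∧ ∀ (k : Fin 2) (n m : ℕ), 3 ≤ n → n ≤ m → m ≤ n.choose 2 →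
      (DynExplore.windowSizes k n m).Nonempty ∧
      (DynExplore.psi k n m : ℝ) ≤
        C * (DynExplore.eps n m * (m : ℝ) + (n : ℝ) * (Real.logb 2 (n : ℝ)) ^ 2) := by
  refine ⟨28, by norm_num, fun k n m hn hm hm' => ?_⟩
  have h := DynExplore.mem_windowSizes hn hm hm' k
  refine ⟨⟨_, h⟩, (Nat.cast_le.2 (Nat.sInf_le h)).trans (Nat.floor_le ?_)⟩
  have := DynExplore.half_le_eps hn hm hm'
  positivity
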